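/- **Setting.** Write $L^2=L^2(\mathbb R;\mathbb C)$ with $\langle f,g\rangle=\int f\bar g$, $\langle k\rangle=(1+|k|^2)^{1/2}$, and $\Box_k=\mathscr F^{-1}\chi_{[k-1/2,k+1/2]}\mathscr F$ for $k\in\mathbb Z$ (on tempered distributions whose Fourier transform is a locally square integrable function). A partition $\mathrm t$ is a finite sequence $-\infty=t_0<t_1<\dots<t_K=\infty$; partitions are ordered by inclusion. *$U^2$.* An atom is a function $a=\sum_{k=1}^K\chi_{[t_{k-1},t_k)}\phi_{k-1}:\mathbb R\to L^2$ with $\phi_0=0$ and $\sum_{k=0}^{K-1}\|\phi_k\|_2^2=1$. $U^2$ is the space of all $u=\sum_{j\ge1}c_ja_j$ with atoms $a_j$, $c_j\in\mathbb C$, $\sum|c_j|<\infty$, and $\|u\|_{U^2}$ is the infimum of $\sum|c_j|$ over all such representations. *$V^2$.* $V^2$ is the space of all $v:\mathbb R\to L^2$ for which $\lim_{t\to\pm\infty}v(t)$ exist and $$\|v\|_{V^2}=\sup_{\mathrm t}\Big(\sum_{k=1}^K\|v(t_k)-v(t_{k-1})\|_2^2\Big)^{1/2}<\infty ,$$ with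 the conventions $v(-\infty)=\lim_{t\to-\infty}v(t)$ and $v(\infty)=0$. *$X^s_q$ and $Y^s_q$.* For $s\in\mathbb R$, $1\le q\le\infty$, $X^s_q$ (resp. $Y^s_q$) is the space of all functions $u$ from $\mathbb R$ to the tempered distributions with locally square integrable Fourier transform such that $\Box_ku\in U^2$ (resp. $V^2$) for all $k\in\mathbb Z$ and $$\|u\|_{X^s_q}=\big\|\big(\langle k\rangle^s\|\Box_ku\|_{U^2}\big)_k\big\|_{\ell^q(\mathbb Z)}<\infty\qquad\Big(\text{resp. }\|u\|_{Y^s_q}=\big\|\big(\langle k\rangle^s\|\Box_ku\|_{V^2}\big)_k\big\|_{\ell^q(\mathbb Z)}<\infty\Big).$$ *$B$.* $B(u,v)$ is the limit, along the partitions ordered by inclusion, of $$B_{\mathrm t}(u,v)=\sum_{k=1}^K\langle u(t_{k-1}),v(t_k)-v(t_{k-1})\rangle,$$ with the same conventions at $\pm\infty$, where for distributions $\langle f,g\rangle:=\sum_{k\in\mathbb Z}\langle\Box_kf,\Box_kg\rangle$. **Proposition (duality of $X^s_q$ and $Y^{-s}_{q'}$).** Let $s\in\mathbb R$, $1\le q<\infty$,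 $1/q+1/q'=1$. For all $u\in X^s_q$ and $v\in Y^{-s}_{q'}$ the series $\sum_k\langle\Box_ku(t),\Box_kv(t')\rangle$ $(t,t'\in\mathbb R)$ converge absolutely and the limit $B(u,v)$ exists; if moreover $u\in U^2$ and $v\in V^2$, then $B(u,v)$ is the limit of the sums $B_{\mathrm t}(u,v)$ formed with the inner product of $L^2$. Furthermore $$|B(u,v)|\le\|u\|_{X^s_q}\|v\|_{Y^{-s}_{q'}},$$ and $T(v)=B(\cdot,v)$ defines a (conjugate-linear) isometry $T$ from $Y^{-s}_{q'}$ onto the dual space $(X^s_q)^*$. -/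

import Mathlib

open MeasureTheory Filter Topology SchwartzMap FourierTransform
open scoped ENNReal

noncomputable section

namespace UVDuality

/-- The complex Hilbert space `L²(ℝ)`. -/
abbrev L2 : Type := Lp ℂ 2 (volume : Measure ℝ)

/-! ### Partitions of the line -/

/-- A finite partition `-∞ = t₀ < t₁ < ⋯ < t_K = ∞` is given by the finite set `τ` of its interior
points, so `K = τ.card + 1`; `node τ k` is `t_k` for `k ≤ K` (and `∞` for `k > K`).
Refinement of partitions is inclusion of the sets `τ`. -/
def node (τ : Finset ℝ) : ℕ → EReal
  | 0 => ⊥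
  | k + 1 => if h : k < τ.card then ((τ.orderEmbOfFin rfl ⟨k, h⟩ : ℝ) : EReal) else ⊤

lemma node_mono (τ : Finset ℝ) : Monotone (node τ) := by
  refine monotone_nat_of_le_succ fun n => ?_
  cases n with
  | zero => simp [node]
  | succ n =>
    simp only [node]
    split_ifs with h1 h2
    · exact EReal.coe_le_coe_iff.2 ((τ.orderEmbOfFin rfl).monotone (by simp))
    · exact le_top
    · omega
    · exact le_rfl

/-- The values of `v` at the points of `[-∞, ∞]`: `v(-∞) = lim_{t → -∞} v(t)` and `v(∞) = 0`. -/
def extend {E : Type*} [TopologicalSpace E] [Zero E] (v : ℝ → E) : EReal → E :=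
  fun x => if x = ⊥ then @limUnder _ _ _ ⟨0⟩ atBot v else if x = ⊤ then 0 else v x.toReal

/-- The partition sum `B_t(u,v) = ∑_{k=1}^K ⟨u(t_{k-1}), v(t_k) - v(t_{k-1})⟩`. -/
def partitionSum {E : Type*} [TopologicalSpace E] [AddGroup E] (form : E → E → ℂ)
    (u v : ℝ → E) (τ : Finset ℝ) : ℂ :=
  ∑ k ∈ Finset.range (τ.card + 1),
    form (extend u (node τ k)) (extend v (node τ (k + 1)) - extend v (node τ k))

/-! ### The space `U²` -/

/-- `a = ∑_{k=1}^K χ_{[t_{k-1}, t_k)} φ_{k-1}` with `∑ ‖φ_k‖² = 1` and `φ₀ = 0`. -/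
def IsAtom (a : ℝ → L2) : Prop :=
  ∃ (τ : Finset ℝ) (φ : ℕ → L2), φ 0 = 0 ∧ ∑ k ∈ Finset.range (τ.card + 1), ‖φ k‖ ^ 2 = 1 ∧
    ∀ t : ℝ, a t = ∑ k ∈ Finset.range (τ.card + 1),
      (Set.Ico (node τ k) (node τ (k + 1))).indicator (fun _ => φ k) (t : EReal)

/-- `u = ∑ c_j a_j` is an atomic decomposition with absolutely summable coefficients. -/
def IsAtomicDecomposition (u : ℝ → L2) (c : ℕ → ℂ) (a : ℕ → ℝ → L2) : Prop :=
  (∀ j, IsAtom (a j)) ∧ Summable (fun j => ‖c j‖) ∧ ∀ t, HasSum (fun j => c j • a j t) (u t)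

lemma exists_atom : ∃ a, IsAtom a := by
  obtain ⟨e, he⟩ : ∃ e : L2, ‖e‖ = 1 := by
    refine ⟨indicatorConstLp 2 (measurableSet_Icc (a := (0 : ℝ)) (b := 1)) (by simp) 1, ?_⟩
    rw [norm_indicatorConstLp (by simp) (by simp)]
    simp
  exact ⟨_, {0}, fun k => if k = 0 then 0 else e, by simp, by simp [Finset.sum_range_succ, he],
    fun t => rfl⟩

lemma IsAtom.norm_le {a : ℝ → L2} (ha : IsAtom a) (t : ℝ) : ‖a t‖ ≤ 1 := by
  obtain ⟨τ, φ, -, h1, h⟩ := ha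
  rw [h t]
  by_cases hk : ∃ k ∈ Finset.range (τ.card + 1), (t : EReal) ∈ Set.Ico (node τ k) (node τ (k + 1))
  · obtain ⟨k, hk, hkt⟩ := hk
    rw [Finset.sum_eq_single_of_mem k hk, Set.indicator_of_mem hkt]
    · have := Finset.single_le_sum (f := fun k => ‖φ k‖ ^ 2) (fun i _ => by positivity) hk
      rw [h1] at this
      exact (sq_le_one_iff₀ (norm_nonneg _)).1 this
    · intro l _ hl
      refine Set.indicator_of_notMem (fun hlt => ?_) _
      rcases lt_or_gt_of_ne hl with hl | hl
      · exact absurd (hlt.2.trans_le ((node_mono τ hl).trans hkt.1)) (lt_irrefl _)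
      · exact absurd (hkt.2.trans_le ((node_mono τ hl).trans hlt.1)) (lt_irrefl _)
  · push Not at hk
    rw [Finset.sum_eq_zero fun k hk' => Set.indicator_of_notMem (hk k hk') _]
    simp

lemma IsAtomicDecomposition.norm_le {u : ℝ → L2} {c a} (h : IsAtomicDecomposition u c a) (t : ℝ) :
    ‖u t‖ ≤ ∑' j, ‖c j‖ := by
  rw [← (h.2.2 t).tsum_eq]
  have hle : ∀ j, ‖c j • a j t‖ ≤ ‖c j‖ := fun j => by
    rw [norm_smul]
    exact mul_le_of_le_one_right (norm_nonneg _) ((h.1 j).norm_le t)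
  have hs : Summable fun j => ‖c j • a j t‖ := h.2.1.of_nonneg_of_le (fun _ => norm_nonneg _) hle
  exact (norm_tsum_le_tsum_norm hs).trans (hs.tsum_le_tsum hle h.2.1)

lemma exists_add {u v : ℝ → L2} {c a c' a'} (h : IsAtomicDecomposition u c a)
    (h' : IsAtomicDecomposition v c' a') : ∃ c'' a'', IsAtomicDecomposition (u + v) c'' a'' ∧
      ∑' j, ‖c'' j‖ = ∑' j, ‖c j‖ + ∑' j, ‖c' j‖ := by
  let e := Equiv.natSumNatEquivNat.symm
  have key : ∀ {E : Type} [NormedAddCommGroup E] (f g : ℕ → E) (x y : E), HasSum f x →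
      HasSum g y → HasSum (Sum.elim f g ∘ e) (x + y) := by
    intro E _ f g x y hf hg
    rw [Equiv.hasSum_iff]
    exact hf.sum (f := Sum.elim f g) hg
  have hn := key _ _ _ _ h.2.1.hasSum h'.2.1.hasSum
  have e1 : (Sum.elim (fun j => ‖c j‖) (fun j => ‖c' j‖) ∘ e) =
      fun j => ‖(Sum.elim c c' ∘ e) j‖ := by
    funext j; simp only [Function.comp]; cases e j <;> rfl
  rw [e1] at hn
  refine ⟨Sum.elim c c' ∘ e, Sum.elim a a' ∘ e, ⟨fun j => ?_, hn.summable, fun t => ?_⟩, hn.tsum_eq⟩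
  · simp only [Function.comp]; cases e j
    · exact h.1 _
    · exact h'.1 _
  · have := key _ _ _ _ (h.2.2 t) (h'.2.2 t)
    have e2 : (Sum.elim (fun j => c j • a j t) (fun j => c' j • a' j t) ∘ e) =
        fun j => (Sum.elim c c' ∘ e) j • (Sum.elim a a' ∘ e) j t := by
      funext j; simp only [Function.comp]; cases e j <;> rfl
    rw [e2] at this
    exact this

lemma IsAtomicDecomposition.smul {u : ℝ → L2} {c a} (h : IsAtomicDecomposition u c a) (z : ℂ) :
    IsAtomicDecomposition (z • u) (fun j => z * c j) a :=
  ⟨h.1, by simpa only [norm_mul] using h.2.1.mul_left ‖z‖,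
    fun t => by
      simp only [mul_smul]
      exact (h.2.2 t).const_smul z⟩

lemma exists_zero : ∃ c a, IsAtomicDecomposition 0 c a ∧ ∑' j, ‖c j‖ = 0 := by
  obtain ⟨a, ha⟩ := exists_atom
  exact ⟨fun _ => 0, fun _ => a, ⟨fun _ => ha, by simp, fun t => by simp⟩,
    by simp⟩

/-- The functions `u = ∑ c_j a_j`, as a vector space. -/
def U2Submodule : Submodule ℂ (ℝ → L2) where
  carrier := {u | ∃ c a, IsAtomicDecomposition u c a}
  zero_mem' := by
    obtain ⟨c, a, h, -⟩ := exists_zero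
    exact ⟨c, a, h⟩
  add_mem' := by
    rintro u v ⟨c, a, h⟩ ⟨c', a', h'⟩
    obtain ⟨c'', a'', h'', -⟩ := exists_add h h'
    exact ⟨c'', a'', h''⟩
  smul_mem' := by
    rintro z u ⟨c, a, h⟩
    exact ⟨_, _, h.smul z⟩

/-- The space `U²`. -/
def U2 : Type := ↥U2Submodule

instance : AddCommGroup U2 := inferInstanceAs (AddCommGroup ↥U2Submodule)
instance : Module ℂ U2 := inferInstanceAs (Module ℂ ↥U2Submodule)

/-- An element of `U²` as a function of time. -/
def U2.toFun : U2 →ₗ[ℂ] (ℝ → L2) := U2Submodule.subtype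

lemma U2.toFun_injective : Function.Injective U2.toFun := Subtype.val_injective

/-- `‖u‖_{U²}`: the infimum of `∑ |c_j|` over all atomic decompositions `u = ∑ c_j a_j`. -/
def U2Norm (u : ℝ → L2) : ℝ :=
  sInf {r | ∃ c a, IsAtomicDecomposition u c a ∧ r = ∑' j, ‖c j‖}

lemma U2Norm_le {u : ℝ → L2} {c a} (h : IsAtomicDecomposition u c a) : U2Norm u ≤ ∑' j, ‖c j‖ :=
  csInf_le ⟨0, by rintro r ⟨c, a, -, rfl⟩; exact tsum_nonneg fun _ => norm_nonneg _⟩ ⟨c, a, h, rfl⟩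

lemma U2Norm_nonneg (u : ℝ → L2) : 0 ≤ U2Norm u :=
  Real.sInf_nonneg (by rintro r ⟨c, a, -, rfl⟩; exact tsum_nonneg fun _ => norm_nonneg _)

lemma exists_lt (u : U2) {ε : ℝ} (hε : 0 < ε) :
    ∃ c a, IsAtomicDecomposition u.toFun c a ∧ ∑' j, ‖c j‖ < U2Norm u.toFun + ε := by
  obtain ⟨c, a, h⟩ := u.2
  obtain ⟨r, ⟨c, a, h, rfl⟩, hr⟩ := exists_lt_of_csInf_lt
    (s := {r | ∃ c a, IsAtomicDecomposition u.toFun c a ∧ r = ∑' j, ‖c j‖}) ⟨_, c, a, h, rfl⟩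
    (lt_add_of_pos_right _ hε)
  exact ⟨c, a, h, hr⟩

lemma U2.norm_apply_le (u : U2) (t : ℝ) : ‖u.toFun t‖ ≤ U2Norm u.toFun := by
  refine le_of_forall_pos_le_add fun ε hε => ?_
  obtain ⟨c, a, h, hr⟩ := exists_lt u hε
  exact (h.norm_le t).trans hr.le

/-- The norm of `U²`, as a seminorm on the vector space `U²`. -/
def U2Seminorm : Seminorm ℂ U2 :=
  Seminorm.ofSMulLE (fun u => U2Norm u.toFun)
    (by
      obtain ⟨c, a, h, h0⟩ := exists_zero
      exact le_antisymm (by simpa [h0] using U2Norm_le h) (U2Norm_nonneg _))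
    (fun u v => by
      refine le_of_forall_pos_le_add fun ε hε => ?_
      obtain ⟨c, a, h, hr⟩ := exists_lt u (half_pos hε)
      obtain ⟨c', a', h', hr'⟩ := exists_lt v (half_pos hε)
      obtain ⟨c'', a'', h'', hr''⟩ := exists_add h h'
      rw [map_add]
      linarith [U2Norm_le h''])
    (fun z u => by
      refine le_of_forall_pos_le_add fun ε hε => ?_
      have hz : 0 < ‖z‖ + 1 := by positivity
      obtain ⟨c, a, h, hr⟩ := exists_lt u (div_pos hε hz)
      have := U2Norm_le (h.smul z)
      simp only [norm_mul, tsum_mul_left] at this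
      rw [map_smul]
      have h2 : ‖z‖ * (ε / (‖z‖ + 1)) ≤ ε := by
        rw [mul_div_assoc', div_le_iff₀ hz]; nlinarith
      nlinarith [norm_nonneg z])

instance : Norm U2 := ⟨fun u => U2Norm u.toFun⟩

lemma U2.core : NormedSpace.Core ℂ U2 where
  norm_nonneg u := U2Norm_nonneg _
  norm_smul z u := map_smul_eq_mul U2Seminorm z u
  norm_triangle u v := map_add_le_add U2Seminorm u v
  norm_eq_zero_iff u := by
    refine ⟨fun h => U2.toFun_injective (funext fun t => ?_), ?_⟩
    · have := u.norm_apply_le t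
      rw [show U2Norm u.toFun = 0 from h] at this
      simpa using this
    · rintro rfl
      exact map_zero U2Seminorm

instance : NormedAddCommGroup U2 := NormedAddCommGroup.ofCore U2.core
instance : NormedSpace ℂ U2 := NormedSpace.ofCore U2.core

/-! ### The space `V²` -/

/-- `(∑_{k=1}^K ‖v(t_k) - v(t_{k-1})‖²)^{1/2}`, with the conventions of `extend`. -/
def variationSum (v : ℝ → L2) (τ : Finset ℝ) : ℝ :=
  √(∑ k ∈ Finset.range (τ.card + 1),
    ‖extend v (node τ (k + 1)) - extend v (node τ k)‖ ^ 2)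

/-- `‖v‖_{V²}`: the supremum over all partitions. -/
def V2Norm (v : ℝ → L2) : ℝ := ⨆ τ : Finset ℝ, variationSum v τ

/-- `v` has limits at `±∞` and finite `V²` norm. -/
def IsV2 (v : ℝ → L2) : Prop :=
  (∃ l, Tendsto v atBot (𝓝 l)) ∧ (∃ l, Tendsto v atTop (𝓝 l)) ∧
    BddAbove (Set.range (variationSum v))

lemma extend_add {u v : ℝ → L2} (hu : ∃ l, Tendsto u atBot (𝓝 l))
    (hv : ∃ l, Tendsto v atBot (𝓝 l)) (x : EReal) : extend (u + v) x = extend u x + extend v x := by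
  obtain ⟨l, hl⟩ := hu
  obtain ⟨m, hm⟩ := hv
  unfold extend
  split_ifs
  · rw [hl.limUnder_eq, hm.limUnder_eq]
    exact (hl.add hm).limUnder_eq
  · simp
  · rfl

lemma extend_smul {v : ℝ → L2} (z : ℂ) (hv : ∃ l, Tendsto v atBot (𝓝 l)) (x : EReal) :
    extend (z • v) x = z • extend v x := by
  obtain ⟨m, hm⟩ := hv
  unfold extend
  split_ifs
  · rw [hm.limUnder_eq]
    exact (hm.const_smul z).limUnder_eq
  · simp
  · rfl

lemma variationSum_eq (v : ℝ → L2) (τ : Finset ℝ) : variationSum v τ =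
    ‖WithLp.toLp 2 (fun k : Fin (τ.card + 1) =>
      extend v (node τ (k + 1)) - extend v (node τ k))‖ := by
  rw [PiLp.norm_eq_of_L2, variationSum, Finset.sum_range]

lemma variationSum_add {u v : ℝ → L2} (hu : ∃ l, Tendsto u atBot (𝓝 l))
    (hv : ∃ l, Tendsto v atBot (𝓝 l)) (τ : Finset ℝ) :
    variationSum (u + v) τ ≤ variationSum u τ + variationSum v τ := by
  simp only [variationSum_eq, extend_add hu hv]
  refine le_trans (le_of_eq ?_) (norm_add_le _ _)
  congr 1
  ext1 k
  simp only [PiLp.add_apply]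
  abel

lemma variationSum_smul {v : ℝ → L2} (z : ℂ) (hv : ∃ l, Tendsto v atBot (𝓝 l)) (τ : Finset ℝ) :
    variationSum (z • v) τ = ‖z‖ * variationSum v τ := by
  simp only [variationSum_eq, extend_smul z hv]
  rw [← norm_smul]
  congr 1
  ext1 k
  simp only [PiLp.smul_apply, smul_sub]

lemma variationSum_zero (τ : Finset ℝ) : variationSum 0 τ = 0 := by
  have := variationSum_smul (v := 0) 0 ⟨0, tendsto_const_nhds⟩ τ
  simpa using this

lemma variationSum_nonneg (v : ℝ → L2) (τ : Finset ℝ) : 0 ≤ variationSum v τ := Real.sqrt_nonneg _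

/-- The functions that have limits at `±∞` and finite `V²` norm, as a vector space. -/
def V2Submodule : Submodule ℂ (ℝ → L2) where
  carrier := {v | IsV2 v}
  zero_mem' := ⟨⟨0, tendsto_const_nhds⟩, ⟨0, tendsto_const_nhds⟩,
    0, by rintro _ ⟨τ, rfl⟩; exact (variationSum_zero τ).le⟩
  add_mem' := by
    rintro u v ⟨⟨l, hl⟩, ⟨m, hm⟩, C, hC⟩ ⟨⟨l', hl'⟩, ⟨m', hm'⟩, C', hC'⟩
    refine ⟨⟨_, hl.add hl'⟩, ⟨_, hm.add hm'⟩, C + C', ?_⟩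
    rintro _ ⟨τ, rfl⟩
    exact (variationSum_add ⟨l, hl⟩ ⟨l', hl'⟩ τ).trans (add_le_add (hC ⟨τ, rfl⟩) (hC' ⟨τ, rfl⟩))
  smul_mem' := by
    rintro z v ⟨⟨l, hl⟩, ⟨m, hm⟩, C, hC⟩
    refine ⟨⟨_, hl.const_smul z⟩, ⟨_, hm.const_smul z⟩, ‖z‖ * C, ?_⟩
    rintro _ ⟨τ, rfl⟩
    rw [variationSum_smul z ⟨l, hl⟩]
    exact mul_le_mul_of_nonneg_left (hC ⟨τ, rfl⟩) (norm_nonneg _)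

/-- The space `V²`. -/
def V2 : Type := ↥V2Submodule

instance : AddCommGroup V2 := inferInstanceAs (AddCommGroup ↥V2Submodule)
instance : Module ℂ V2 := inferInstanceAs (Module ℂ ↥V2Submodule)

/-- An element of `V²` as a function of time. -/
def V2.toFun : V2 →ₗ[ℂ] (ℝ → L2) := V2Submodule.subtype

lemma V2.toFun_injective : Function.Injective V2.toFun := Subtype.val_injective

lemma V2.isV2 (v : V2) : IsV2 v.toFun := v.2

lemma V2.le_norm (v : V2) (τ : Finset ℝ) : variationSum v.toFun τ ≤ V2Norm v.toFun :=
  le_ciSup v.isV2.2.2 τ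

lemma V2Norm_nonneg (v : ℝ → L2) : 0 ≤ V2Norm v := Real.iSup_nonneg (variationSum_nonneg v)

lemma V2.norm_apply_le (v : V2) (t : ℝ) : ‖v.toFun t‖ ≤ V2Norm v.toFun := by
  refine le_trans ?_ (v.le_norm {t})
  have h2 : node {t} 2 = ⊤ := by simp [node]
  have h1 : node {t} 1 = t := by
    have := Finset.orderEmbOfFin_mem {t} (rfl : ({t} : Finset ℝ).card = _) ⟨0, by simp⟩
    have h0 : 0 < ({t} : Finset ℝ).card := by simp
    simp only [node, dif_pos h0]
    exact_mod_cast Finset.mem_singleton.1 this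
  refine Real.le_sqrt_of_sq_le ?_
  simp only [Finset.card_singleton, Finset.sum_range_succ, Finset.sum_range_zero, zero_add,
    Nat.reduceAdd, h1, h2]
  have e2 : extend v.toFun ⊤ = 0 := by simp [extend]
  have e1 : extend v.toFun t = v.toFun t := by simp [extend]
  rw [e2, e1, zero_sub, norm_neg]
  nlinarith [sq_nonneg ‖v.toFun t - extend v.toFun (node {t} 0)‖]

/-- The norm of `V²`, as a seminorm on the vector space `V²`. -/
def V2Seminorm : Seminorm ℂ V2 :=
  Seminorm.ofSMulLE (fun v => V2Norm v.toFun)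
    (by
      refine le_antisymm (ciSup_le fun τ => ?_) (V2Norm_nonneg _)
      rw [map_zero]
      exact (variationSum_zero τ).le)
    (fun u v => by
      refine ciSup_le fun τ => ?_
      rw [map_add]
      exact (variationSum_add u.isV2.1 v.isV2.1 τ).trans (add_le_add (u.le_norm τ) (v.le_norm τ)))
    (fun z v => by
      refine ciSup_le fun τ => ?_
      rw [map_smul, variationSum_smul z v.isV2.1]
      exact mul_le_mul_of_nonneg_left (v.le_norm τ) (norm_nonneg _))

instance : Norm V2 := ⟨fun v => V2Norm v.toFun⟩

lemma V2.core : NormedSpace.Core ℂ V2 where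
  norm_nonneg v := V2Norm_nonneg _
  norm_smul z v := map_smul_eq_mul V2Seminorm z v
  norm_triangle u v := map_add_le_add V2Seminorm u v
  norm_eq_zero_iff v := by
    refine ⟨fun h => V2.toFun_injective (funext fun t => ?_), ?_⟩
    · have := v.norm_apply_le t
      rw [show V2Norm v.toFun = 0 from h] at this
      simpa using this
    · rintro rfl
      exact map_zero V2Seminorm

instance : NormedAddCommGroup V2 := NormedAddCommGroup.ofCore V2.core
instance : NormedSpace ℂ V2 := NormedSpace.ofCore V2.core

/-! ### The frequency projections `□_k` -/

/-- The Fourier transform of the tempered distribution `f` is the locally square integrable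
function `F`. -/
def IsFourier (f : 𝓢'(ℝ, ℂ)) (F : ℝ → ℂ) : Prop :=
  (∀ K : Set ℝ, IsCompact K → MemLp F 2 (volume.restrict K)) ∧
    ∀ φ : 𝓢(ℝ, ℂ), Integrable (fun ξ => φ ξ • F ξ) ∧ (𝓕 f) φ = ∫ ξ, φ ξ • F ξ

lemma IsFourier.add {f g : 𝓢'(ℝ, ℂ)} {F G} (hf : IsFourier f F) (hg : IsFourier g G) :
    IsFourier (f + g) (F + G) := by
  refine ⟨fun K hK => (hf.1 K hK).add (hg.1 K hK), fun φ => ?_⟩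
  obtain ⟨hf1, hf2⟩ := hf.2 φ
  obtain ⟨hg1, hg2⟩ := hg.2 φ
  simp only [Pi.add_apply, smul_add]
  refine ⟨hf1.add hg1, ?_⟩
  rw [integral_add hf1 hg1, ← hf2, ← hg2, FourierTransform.fourier_add]
  rfl

lemma IsFourier.smul {f : 𝓢'(ℝ, ℂ)} {F} (hf : IsFourier f F) (z : ℂ) :
    IsFourier (z • f) (z • F) := by
  refine ⟨fun K hK => (hf.1 K hK).const_smul z, fun φ => ?_⟩
  obtain ⟨hf1, hf2⟩ := hf.2 φ
  have e : (fun ξ => φ ξ • (z • F) ξ) = fun ξ => z • (φ ξ • F ξ) := by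
    funext ξ; simp only [Pi.smul_apply, smul_eq_mul]; ring
  rw [e]
  refine ⟨hf1.smul z, ?_⟩
  rw [integral_smul, ← hf2, FourierTransform.fourier_smul]
  rfl

lemma IsFourier.locallyIntegrable {f : 𝓢'(ℝ, ℂ)} {F} (hf : IsFourier f F) :
    LocallyIntegrable F := by
  rw [locallyIntegrable_iff]
  intro K hK
  have : IsFiniteMeasure (volume.restrict K) := ⟨by simpa using hK.measure_lt_top⟩
  exact (hf.1 K hK).integrable (by norm_num)

lemma IsFourier.ae_eq {f : 𝓢'(ℝ, ℂ)} {F G} (hF : IsFourier f F) (hG : IsFourier f G) :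
    F =ᵐ[volume] G := by
  refine ae_eq_of_integral_contDiff_smul_eq hF.locallyIntegrable hG.locallyIntegrable ?_
  intro g hg hgc
  have hg' : ContDiff ℝ ((⊤ : ℕ∞) : WithTop ℕ∞) (fun x => (g x : ℂ)) :=
    Complex.ofRealCLM.contDiff.comp hg
  have hgc' : HasCompactSupport (fun x => (g x : ℂ)) := hgc.comp_left (g := Complex.ofReal) rfl
  have h := (hF.2 (hgc'.toSchwartzMap hg')).2.symm.trans (hG.2 (hgc'.toSchwartzMap hg')).2
  simpa using h

/-- The tempered distributions whose Fourier transform is a locally square integrable function. -/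
def FourierL2loc : Submodule ℂ 𝓢'(ℝ, ℂ) where
  carrier := {f | ∃ F, IsFourier f F}
  zero_mem' := ⟨0, fun _ _ => MemLp.zero, fun φ => by
    refine ⟨by simp, ?_⟩
    have : 𝓕 (0 : 𝓢'(ℝ, ℂ)) = 0 := FourierTransform.fourier_zero
    rw [this]; simp⟩
  add_mem' := by
    rintro f g ⟨F, hF⟩ ⟨G, hG⟩
    exact ⟨_, hF.add hG⟩
  smul_mem' := by
    rintro z f ⟨F, hF⟩
    exact ⟨_, hF.smul z⟩

/-- The Fourier transform of `f`, as a function. -/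
def fhat (f : FourierL2loc) : ℝ → ℂ := f.2.choose

lemma fhat_spec (f : FourierL2loc) : IsFourier f.1 (fhat f) := f.2.choose_spec

/-- The band of angular frequencies in `[k - 1/2, k + 1/2]`; Mathlib's Fourier transform
`∫ e^{-2πixξ} f(x) dx` has the angular frequency `2πξ`. -/
def band (k : ℤ) : Set ℝ := {ξ | 2 * Real.pi * ξ ∈ Set.Icc (k - 1 / 2 : ℝ) (k + 1 / 2)}

lemma band_eq (k : ℤ) : band k =
    Set.Icc ((k - 1 / 2 : ℝ) / (2 * Real.pi)) ((k + 1 / 2) / (2 * Real.pi)) := by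
  ext ξ
  rw [Set.mem_Icc, div_le_iff₀ Real.two_pi_pos, le_div_iff₀ Real.two_pi_pos, mul_comm ξ]
  rfl

lemma memLp_band (k : ℤ) (f : FourierL2loc) :
    MemLp ((band k).indicator (fhat f)) 2 (volume : Measure ℝ) := by
  rw [memLp_indicator_iff_restrict (by rw [band_eq]; exact measurableSet_Icc)]
  exact (fhat_spec f).1 _ (by rw [band_eq]; exact isCompact_Icc)

/-- `□_k f = 𝓕⁻¹ χ_{[k-1/2, k+1/2]} 𝓕 f`. -/
def box (k : ℤ) : FourierL2loc →ₗ[ℂ] L2 where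
  toFun f := 𝓕⁻ ((memLp_band k f).toLp : L2)
  map_add' f g := by
    rw [← FourierTransform.fourierInv_add, ← MemLp.toLp_add]
    congr 1
    refine MemLp.toLp_congr _ _ ?_
    filter_upwards [(fhat_spec (f + g)).ae_eq ((fhat_spec f).add (fhat_spec g))] with ξ h
    by_cases hξ : ξ ∈ band k <;> simp [hξ, h]
  map_smul' z f := by
    rw [RingHom.id_apply, ← FourierTransform.fourierInv_smul, ← MemLp.toLp_const_smul]
    congr 1
    refine MemLp.toLp_congr _ _ ?_
    filter_upwards [(fhat_spec (z • f)).ae_eq ((fhat_spec f).smul z)] with ξ h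
    by_cases hξ : ξ ∈ band k <;> simp [hξ, h]

lemma eq_zero_of_box (f : FourierL2loc) (h : ∀ k, box k f = 0) : f = 0 := by
  have h1 : ∀ k, (band k).indicator (fhat f) =ᵐ[volume] 0 := by
    intro k
    have h2 : ((memLp_band k f).toLp : L2) = 0 := by
      have := congrArg (fun g : L2 => 𝓕 g) (h k)
      simpa [box, FourierTransform.fourier_fourierInv_eq] using this
    exact (MemLp.toLp_eq_toLp_iff (memLp_band k f) MemLp.zero).1 h2
  have h3 : fhat f =ᵐ[volume] 0 := by
    filter_upwards [ae_all_iff.2 h1] with ξ hξ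
    have hm : ξ ∈ band (round (2 * Real.pi * ξ)) := by
      have := abs_le.1 (abs_sub_round (2 * Real.pi * ξ))
      exact ⟨by linarith [this.1], by linarith [this.2]⟩
    simpa [hm] using hξ (round (2 * Real.pi * ξ))
  have h4 : 𝓕 f.1 = 0 := by
    ext φ
    rw [((fhat_spec f).2 φ).2]
    refine integral_eq_zero_of_ae ?_
    filter_upwards [h3] with ξ hξ
    simp [hξ]
  apply Subtype.ext
  have : 𝓕⁻ (𝓕 f.1) = f.1 := FourierTransform.fourierInv_fourier_eq f.1
  rw [h4] at this
  rw [← this]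
  exact FourierTransform.fourierInv_zero

/-! ### The spaces `X^s_q` and `Y^s_q` -/

/-- `⟨k⟩ˢ`, where `⟨k⟩ = (1 + |k|²)^{1/2}`. -/
def weight (s : ℝ) (k : ℤ) : ℝ := √(1 + (k : ℝ) ^ 2) ^ s

section Blocks

variable {W : Type} [NormedAddCommGroup W] [NormedSpace ℂ W]

/-- For a normed space `W` of functions `ℝ → L²`: the functions `u` from `ℝ` to the tempered
distributions such that `□_k u ∈ W` for all `k` and `(⟨k⟩ˢ ‖□_k u‖_W)_k ∈ ℓ^q`. -/
def blockSubmodule (j : W →ₗ[ℂ] (ℝ → L2)) (s : ℝ) (q : ℝ≥0∞) : Submodule ℂ (ℝ → FourierL2loc) where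
  carrier := {u | ∃ g : ℤ → W, (∀ k t, j (g k) t = box k (u t)) ∧
    Memℓp (fun k => (weight s k : ℂ) • g k) q}
  zero_mem' := ⟨0, by simp, by
    simp only [Pi.zero_apply, smul_zero]
    exact zero_memℓp⟩
  add_mem' := by
    rintro u v ⟨g, hg, hg'⟩ ⟨h, hh, hh'⟩
    exact ⟨g + h, fun k t => by simp [hg, hh], by
      simp only [Pi.add_apply, smul_add]
      exact hg'.add hh'⟩
  smul_mem' := by
    rintro z u ⟨g, hg, hg'⟩
    refine ⟨z • g, fun k t => by simp [hg], ?_⟩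
    have := hg'.const_smul z
    convert this using 1
    funext k
    simp [smul_comm z]

/-- The weighted sequence `(⟨k⟩ˢ □_k u)_k`. -/
def blocks (j : W →ₗ[ℂ] (ℝ → L2)) (hj : Function.Injective j) (s : ℝ) (q : ℝ≥0∞) :
    blockSubmodule j s q →ₗ[ℂ] lp (fun _ : ℤ => W) q where
  toFun u := ⟨fun k => (weight s k : ℂ) • u.2.choose k, u.2.choose_spec.2⟩
  map_add' u v := by
    refine lp.ext (funext fun k => ?_)
    simp only [lp.coeFn_add, Pi.add_apply, ← smul_add]
    congr 1
    refine hj (funext fun t => ?_)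
    simp [u.2.choose_spec.1, v.2.choose_spec.1, (u + v).2.choose_spec.1]
  map_smul' z u := by
    refine lp.ext (funext fun k => ?_)
    simp only [lp.coeFn_smul, Pi.smul_apply, RingHom.id_apply]
    rw [smul_comm z]
    congr 1
    refine hj (funext fun t => ?_)
    simp [u.2.choose_spec.1, (z • u).2.choose_spec.1]

lemma blocks_injective (j : W →ₗ[ℂ] (ℝ → L2)) (hj : Function.Injective j) (s : ℝ) (q : ℝ≥0∞) :
    Function.Injective (blocks j hj s q) := by
  rw [injective_iff_map_eq_zero]
  intro u hu
  apply Subtype.ext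
  funext t
  refine eq_zero_of_box _ fun k => ?_
  have h1 : (weight s k : ℂ) • u.2.choose k = 0 := congrFun (congrArg Subtype.val hu) k
  have hw : (weight s k : ℂ) ≠ 0 := by
    have : 0 < weight s k := by unfold weight; positivity
    exact_mod_cast this.ne'
  rw [← u.2.choose_spec.1 k t, (smul_eq_zero.1 h1).resolve_left hw]
  simp

end Blocks

/-- The space `X^s_q`. -/
def X (s : ℝ) (q : ℝ≥0∞) : Type := ↥(blockSubmodule U2.toFun s q)

/-- The space `Y^s_q`. -/
def Y (s : ℝ) (q : ℝ≥0∞) : Type := ↥(blockSubmodule V2.toFun s q)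

section Norms

variable (s : ℝ) (q : ℝ≥0∞)

instance : AddCommGroup (X s q) := inferInstanceAs (AddCommGroup ↥(blockSubmodule U2.toFun s q))
instance : Module ℂ (X s q) := inferInstanceAs (Module ℂ ↥(blockSubmodule U2.toFun s q))
instance : AddCommGroup (Y s q) := inferInstanceAs (AddCommGroup ↥(blockSubmodule V2.toFun s q))
instance : Module ℂ (Y s q) := inferInstanceAs (Module ℂ ↥(blockSubmodule V2.toFun s q))

/-- The sequence `(⟨k⟩ˢ □_k u)_k ∈ ℓ^q(ℤ; U²)`. -/
def X.blocks : X s q →ₗ[ℂ] lp (fun _ : ℤ => U2) q :=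
  UVDuality.blocks U2.toFun U2.toFun_injective s q

/-- The sequence `(⟨k⟩ˢ □_k v)_k ∈ ℓ^q(ℤ; V²)`. -/
def Y.blocks : Y s q →ₗ[ℂ] lp (fun _ : ℤ => V2) q :=
  UVDuality.blocks V2.toFun V2.toFun_injective s q

variable [Fact (1 ≤ q)]

/-- `‖u‖_{X^s_q}` is the `ℓ^q` norm of `(⟨k⟩ˢ ‖□_k u‖_{U²})_k`. -/
instance : NormedAddCommGroup (X s q) :=
  NormedAddCommGroup.induced (X s q) (lp (fun _ : ℤ => U2) q) (X.blocks s q)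
    (blocks_injective U2.toFun U2.toFun_injective s q)

instance : NormedSpace ℂ (X s q) := NormedSpace.induced ℂ (X s q) (lp (fun _ : ℤ => U2) q)
  (X.blocks s q)

/-- `‖v‖_{Y^s_q}` is the `ℓ^q` norm of `(⟨k⟩ˢ ‖□_k v‖_{V²})_k`. -/
instance : NormedAddCommGroup (Y s q) :=
  NormedAddCommGroup.induced (Y s q) (lp (fun _ : ℤ => V2) q) (Y.blocks s q)
    (blocks_injective V2.toFun V2.toFun_injective s q)

instance : NormedSpace ℂ (Y s q) := NormedSpace.induced ℂ (Y s q) (lp (fun _ : ℤ => V2) q)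
  (Y.blocks s q)

end Norms

/-- An element of `X^s_q` as a function of time. -/
def X.toFun {s : ℝ} {q : ℝ≥0∞} (u : X s q) : ℝ → FourierL2loc := u.1

/-- An element of `Y^s_q` as a function of time. -/
def Y.toFun {s : ℝ} {q : ℝ≥0∞} (v : Y s q) : ℝ → FourierL2loc := v.1

/-! ### The bilinear form `B` -/

/-- The inner product `∫ f ḡ` of `L²(ℝ)`, linear in `f`. -/
def innerL2 (f g : L2) : ℂ := inner ℂ g f

/-- The inner product of `L²` extended to distributions by orthogonality of the frequency blocks:
`⟨f, g⟩ = ∑_k ⟨□_k f, □_k g⟩`. -/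
def pairing (f g : FourierL2loc) : ℂ := ∑' k : ℤ, innerL2 (box k f) (box k g)

/-- `B(u, v)`: the limit of the partition sums along the refinement of partitions. -/
def B (u v : ℝ → FourierL2loc) : ℂ :=
  limUnder (atTop : Filter (Finset ℝ)) (partitionSum pairing u v)

end UVDuality

end

noncomputable section

namespace UVDuality

/-! ### Nodes of partitions -/

/-! The theorem combines the duality `(U²)* = V²` on each frequency block with the duality of `ℓ^q`
and `ℓ^{q'}` over the blocks.

On `U² × V²`: against a step function, a partition sum regroups into increments of `v` along a
monotone sequence, one increment per step (`exists_partitionSum_stepFun`). By Cauchy–Schwarz it is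
at most `‖v‖` for an atom, uniformly in the partition, and it is constant once the partition
contains the nodes of the atom. Dominated convergence over an atomic decomposition then gives the
limit `form` and its bound. Conversely, a functional `L` is represented by letting `-v(t)` be the
Riesz vector of `f ↦ L(χ_{[t,∞)} f)`. Intervals are differences of half-lines, so this agrees with
`L` on step functions, which suffices by density; testing with the increments of `v` itself gives
`‖v‖ ≤ ‖L‖` (`TestBound`, `exists_form_eq`).

Over the blocks: partition sums of distributions split into those of the blocks, dominated by `‖□_k
u‖ ‖□_k v‖`, which is summable by Hölder because the weights cancel. Hence `B` is the sum of the
block forms. The value at `-∞` is a limit of tempered distributions, while `U²` and `V²` control one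
block at a time. The gap is closed by rebuilding a distribution continuously from an `L²` sum of
damped blocks (`synth`, `exists_tendsto_of_box`); the same synthesis produces elements of `Y` with
prescribed blocks.

For surjectivity, a functional is restricted to single blocks, each restriction is represented in
`V²` and projected to its band, and the converse of Hölder puts the sequence in the weighted
`ℓ^{q'}`. Since `q < ∞`, an element of `X` is the sum of its single blocks, so the functional is
recovered. The preimage has norm at most that of the functional, which together with injectivity
makes `T` isometric. -/

lemma node_zero (τ : Finset ℝ) : node τ 0 = ⊥ := rfl

lemma node_succ_of_lt {τ : Finset ℝ} {k : ℕ} (h : k < τ.card) :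
    node τ (k + 1) = ((τ.orderEmbOfFin rfl ⟨k, h⟩ : ℝ) : EReal) := by
  simp [node, h]

lemma node_card_add_one (τ : Finset ℝ) : node τ (τ.card + 1) = ⊤ := by
  simp [node]

lemma node_lt_node_succ {τ : Finset ℝ} {k : ℕ} (h : k < τ.card + 1) :
    node τ k < node τ (k + 1) := by
  cases k with
  | zero =>
    by_cases h0 : 0 < τ.card
    · rw [node_succ_of_lt h0, node_zero]; exact EReal.bot_lt_coe _
    · simp [node, h0]
  | succ k =>
    have hk : k < τ.card := by omega
    by_cases h1 : k + 1 < τ.card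
    · rw [node_succ_of_lt hk, node_succ_of_lt h1, EReal.coe_lt_coe_iff]
      exact (τ.orderEmbOfFin rfl).strictMono (by simp)
    · rw [node_succ_of_lt hk, show k + 1 = τ.card by omega, node_card_add_one]
      exact EReal.coe_lt_top _

lemma node_lt_top {τ : Finset ℝ} {k : ℕ} (h : k < τ.card + 1) : node τ k < ⊤ :=
  (node_lt_node_succ h).trans_le le_top

lemma exists_node_eq {τ : Finset ℝ} {t : ℝ} (ht : t ∈ τ) : ∃ k < τ.card, node τ (k + 1) = t := by
  have : t ∈ Set.range (τ.orderEmbOfFin rfl) := by simpa using ht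
  obtain ⟨⟨k, hk⟩, rfl⟩ := this
  exact ⟨k, hk, node_succ_of_lt hk⟩

lemma exists_node_eq_of_subset {σ τ : Finset ℝ} (h : σ ⊆ τ) (k : ℕ) :
    ∃ j ≤ τ.card + 1, node τ j = node σ k := by
  cases k with
  | zero => exact ⟨0, by omega, rfl⟩
  | succ k =>
    by_cases hk : k < σ.card
    · obtain ⟨j, hj, e⟩ := exists_node_eq (h (σ.orderEmbOfFin_mem rfl ⟨k, hk⟩))
      exact ⟨j + 1, by omega, by rw [e, node_succ_of_lt hk]⟩
    · exact ⟨τ.card + 1, le_rfl, by simp [node, hk]⟩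

/-- Values strictly between the two ends are real, so they form the interior points of a partition.
This turns hand-made sequences of times into partitions. -/
lemma exists_node_of_strictMono {n : ℕ} {y : ℕ → EReal} (h0 : y 0 = ⊥) (h1 : y (n + 1) = ⊤)
    (hy : ∀ i < n + 1, y i < y (i + 1)) :
    ∃ τ : Finset ℝ, τ.card = n ∧ ∀ i ≤ n + 1, node τ i = y i := by
  have hlt : ∀ j ≤ n + 1, ∀ i < j, y i < y j := by
    intro j
    induction j with
    | zero => intro _ i hi; omega
    | succ j ih =>
      intro hj i hi
      rcases Nat.lt_succ_iff_lt_or_eq.1 hi with h | rfl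
      · exact (ih (by omega) i h).trans (hy j (by omega))
      · exact hy i (by omega)
  have hco : ∀ i < n, ((y (i + 1)).toReal : EReal) = y (i + 1) := fun i hi =>
    EReal.coe_toReal (h1 ▸ hlt (n + 1) le_rfl (i + 1) (by omega)).ne
      (h0 ▸ hlt (i + 1) (by omega) 0 (by omega)).ne'
  let f : Fin n → ℝ := fun i => (y (i + 1)).toReal
  have hf : StrictMono f := by
    intro i j hij
    rw [← EReal.coe_lt_coe_iff, hco i i.2, hco j j.2]
    exact hlt _ (by omega) _ (by simpa using hij)
  let τ : Finset ℝ := Finset.univ.image f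
  have hcard : τ.card = n := by
    rw [Finset.card_image_of_injective _ hf.injective, Finset.card_univ, Fintype.card_fin]
  refine ⟨τ, hcard, fun i hi => ?_⟩
  cases i with
  | zero => rw [node_zero, h0]
  | succ i =>
    rcases Nat.lt_succ_iff_lt_or_eq.1 (Nat.lt_succ_of_le hi) with h | h
    · have hi' : i < n := by omega
      rw [node_succ_of_lt (by omega), ← hco i hi', EReal.coe_eq_coe_iff]
      have e := Finset.orderEmbOfFin_unique hcard
        (fun x => Finset.mem_image_of_mem f (Finset.mem_univ x)) hf
      have e' := congrFun e ⟨i, hi'⟩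
      rw [show (y (i + 1)).toReal = f ⟨i, hi'⟩ from rfl, e']
      exact (Finset.orderEmbOfFin_eq_orderEmbOfFin_iff ..).2 rfl
    · rw [h, h1, ← hcard, node_card_add_one]

/-- A monotone sequence can be thinned out to a strictly monotone one. -/
lemma exists_strictMono_sum_eq {y : ℕ → EReal} (hy : Monotone y) {d : EReal → EReal → ℝ}
    (hd : ∀ x, d x x = 0) (K : ℕ) :
    ∃ (n : ℕ) (z : ℕ → EReal), z 0 = y 0 ∧ z n = y K ∧ (∀ i < n, z i < z (i + 1)) ∧
      ∑ i ∈ Finset.range n, d (z i) (z (i + 1)) = ∑ k ∈ Finset.range K, d (y k) (y (k + 1)) := by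
  induction K with
  | zero => exact ⟨0, fun _ => y 0, by simp⟩
  | succ K ih =>
    obtain ⟨n, z, h0, hn, hz, hs⟩ := ih
    rcases (hy (Nat.le_succ K)).eq_or_lt with h | h
    · exact ⟨n, z, h0, hn.trans h, hz, by rw [Finset.sum_range_succ, ← hs, ← h, hd, add_zero]⟩
    · refine ⟨n + 1, fun i => if i ≤ n then z i else y (K + 1), by simp [h0], by simp,
        fun i hi => ?_, ?_⟩
      · rcases Nat.lt_succ_iff_lt_or_eq.1 hi with h' | rfl
        · simp [h'.le, Nat.succ_le_of_lt h', hz i h']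
        · simpa [hn] using h
      · rw [Finset.sum_range_succ, Finset.sum_range_succ, ← hs]
        congr 1
        · refine Finset.sum_congr rfl fun i hi => ?_
          have := Finset.mem_range.1 hi
          simp [this.le, Nat.succ_le_of_lt this]
        · simp [hn]

/-- Repeated points contribute zero and can be removed, and adding the ends `±∞` only enlarges the
sum, so the `V²` norm also controls monotone sequences that are not partitions. -/
lemma V2.sum_sq_le (v : V2) {y : ℕ → EReal} (hy : Monotone y) (K : ℕ) :
    ∑ k ∈ Finset.range K, ‖extend v.toFun (y (k + 1)) - extend v.toFun (y k)‖ ^ 2 ≤ ‖v‖ ^ 2 := by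
  -- Shift `y 0, …, y K` to the places `1, …, K + 1`, with `⊥` in front and `⊤` behind; the two
  -- extra increments are dropped at the end.
  let y' : ℕ → EReal := fun k => if k = 0 then ⊥ else if k ≤ K + 1 then y (k - 1) else ⊤
  have hy' : Monotone y' := by
    refine monotone_nat_of_le_succ fun n => ?_
    rcases Nat.eq_zero_or_pos n with rfl | h0
    · simp [y']
    by_cases h1 : n + 1 ≤ K + 1
    · simpa [y', h0.ne', h1, (Nat.le_succ n).trans h1] using hy (Nat.sub_le n 1)
    · simp [y', h1]
  let d : EReal → EReal → ℝ := fun a b => ‖extend v.toFun b - extend v.toFun a‖ ^ 2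
  obtain ⟨n, z, h0, hn, hz, hs⟩ := exists_strictMono_sum_eq hy' (d := d) (by simp [d]) (K + 2)
  have hn' : z n = ⊤ := by simpa [y'] using hn
  have h0' : z 0 = ⊥ := by simpa [y'] using h0
  obtain ⟨m, rfl⟩ : ∃ m, n = m + 1 := by
    refine Nat.exists_eq_succ_of_ne_zero ?_
    rintro rfl
    exact absurd (h0'.symm.trans hn') (by simp)
  obtain ⟨τ, hτ, hτz⟩ := exists_node_of_strictMono h0' hn' hz
  have h1 : ∑ i ∈ Finset.range (m + 1), d (z i) (z (i + 1)) ≤ ‖v‖ ^ 2 := by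
    have h2 := v.le_norm τ
    rw [variationSum, Real.sqrt_le_left (V2Norm_nonneg _), hτ] at h2
    refine le_trans (le_of_eq (Finset.sum_congr rfl fun i hi => ?_)) h2
    have := Finset.mem_range.1 hi
    rw [hτz i (by omega), hτz (i + 1) (by omega)]
  rw [hs, Finset.sum_range_succ', Finset.sum_range_succ] at h1
  have e : ∀ k ∈ Finset.range K, d (y' (k + 1)) (y' (k + 1 + 1)) = d (y k) (y (k + 1)) := by
    intro k hk
    have := Finset.mem_range.1 hk
    simp [y', this.le, Nat.succ_le_of_lt this]
  rw [Finset.sum_congr rfl e] at h1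
  have p1 : 0 ≤ d (y' (K + 1)) (y' (K + 1 + 1)) := by positivity
  have p2 : 0 ≤ d (y' 0) (y' (0 + 1)) := by positivity
  simp only [d] at h1 p1 p2 ⊢
  linarith

/-! ### Step functions -/

/-- The step function with the value `φ k` between the nodes `k` and `k + 1`. -/
def stepFun (τ : Finset ℝ) (φ : ℕ → L2) (t : ℝ) : L2 :=
  ∑ k ∈ Finset.range (τ.card + 1),
    (Set.Ico (node τ k) (node τ (k + 1))).indicator (fun _ => φ k) (t : EReal)

lemma extend_top {E : Type*} [TopologicalSpace E] [Zero E] (v : ℝ → E) : extend v ⊤ = 0 := by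
  simp [extend]

lemma extend_coe {E : Type*} [TopologicalSpace E] [Zero E] (v : ℝ → E) (t : ℝ) :
    extend v t = v t := by
  simp [extend]

lemma extend_bot {E : Type*} [TopologicalSpace E] [T2Space E] [Zero E] {v : ℝ → E} {l : E}
    (h : Tendsto v atBot (𝓝 l)) : extend v ⊥ = l := by
  simpa [extend] using h.limUnder_eq

lemma stepFun_eventually_atBot (τ : Finset ℝ) (φ : ℕ → L2) :
    ∀ᶠ t : ℝ in atBot, stepFun τ φ t = φ 0 := by
  have h : ∃ a : ℝ, (a : EReal) < node τ 1 := by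
    have := node_lt_node_succ (τ := τ) (k := 0) (by omega)
    obtain ⟨a, -, ha⟩ := EReal.lt_iff_exists_real_btwn.1 this
    exact ⟨a, ha⟩
  obtain ⟨a, ha⟩ := h
  filter_upwards [eventually_le_atBot a] with t ht
  have hta : (t : EReal) < node τ 1 := (EReal.coe_le_coe_iff.2 ht).trans_lt ha
  rw [stepFun, Finset.sum_eq_single_of_mem 0 (by simp)]
  · simp [node_zero, hta]
  · intro k _ hk
    refine Set.indicator_of_notMem (fun h => ?_) _
    exact absurd (h.1.trans_lt hta) (not_lt.2 (node_mono τ (Nat.one_le_iff_ne_zero.2 hk)))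

lemma stepFun_tendsto_atBot (τ : Finset ℝ) (φ : ℕ → L2) :
    Tendsto (stepFun τ φ) atBot (𝓝 (φ 0)) :=
  tendsto_const_nhds.congr' ((stepFun_eventually_atBot τ φ).mono fun _ h => h.symm)

lemma extend_stepFun (τ : Finset ℝ) (φ : ℕ → L2) {x : EReal} (hx : x ≠ ⊤) :
    extend (stepFun τ φ) x = ∑ k ∈ Finset.range (τ.card + 1),
      (Set.Ico (node τ k) (node τ (k + 1))).indicator (fun _ => φ k) x := by
  induction x with
  | bot =>
    rw [extend_bot (stepFun_tendsto_atBot τ φ), Finset.sum_eq_single_of_mem 0 (by simp)]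
    · have := node_lt_node_succ (τ := τ) (k := 0) (by omega)
      rw [node_zero] at this
      simp [node_zero, this]
    · intro k hk hk0
      refine Set.indicator_of_notMem (fun h => ?_) _
      obtain ⟨j, rfl⟩ := Nat.exists_eq_succ_of_ne_zero hk0
      have := node_lt_node_succ (τ := τ) (k := j) (by simp at hk; omega)
      exact absurd (bot_le.trans_lt this) (not_lt.2 h.1)
  | coe t => rw [extend_coe, stepFun]
  | top => exact absurd rfl hx

/-- By monotonicity the indices with `s i < x` form an initial segment, so increments over them
telescope. -/
lemma exists_filter_eq_range {s : ℕ → EReal} (hs : Monotone s) (N : ℕ) (x : EReal) :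
    (Finset.range N).filter (fun i => s i < x) =
      Finset.range ((Finset.range N).filter (fun i => s i < x)).card := by
  induction N with
  | zero => simp
  | succ N ih =>
    by_cases h : s N < x
    · have : (Finset.range (N + 1)).filter (fun i => s i < x) = Finset.range (N + 1) :=
        Finset.filter_true_of_mem fun i hi =>
          (hs (Nat.lt_succ_iff.1 (Finset.mem_range.1 hi))).trans_lt h
      simp [this]
    · rw [Finset.range_add_one, Finset.filter_insert, if_neg h]
      exact ih

/-- A partition sum of a step function only sees `v` on a monotone sequence, which consists of the
nodes of the step function if the partition is fine enough. -/
lemma exists_partitionSum_stepFun (σ : Finset ℝ) (φ : ℕ → L2) (v : ℝ → L2) (τ : Finset ℝ) :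
    ∃ y : ℕ → EReal, Monotone y ∧ (σ ⊆ τ → y = node σ) ∧
      partitionSum innerL2 (stepFun σ φ) v τ = ∑ k ∈ Finset.range (σ.card + 1),
        innerL2 (φ k) (extend v (y (k + 1)) - extend v (y k)) := by
  let N := τ.card + 1
  -- `n x` counts the nodes of `τ` below `x`, so `node τ (n x)` is the first node of `τ` that is at
  -- least `x`.
  let n : EReal → ℕ := fun x => ((Finset.range N).filter (fun i => node τ i < x)).card
  have hn : ∀ x, (Finset.range N).filter (fun i => node τ i < x) = Finset.range (n x) :=
    exists_filter_eq_range (node_mono τ) N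
  let Δ : ℕ → L2 := fun i => extend v (node τ (i + 1)) - extend v (node τ i)
  refine ⟨fun k => node τ (n (node σ k)), fun a b hab => node_mono τ ?_, fun h => ?_, ?_⟩
  · refine Finset.card_le_card fun i hi => ?_
    simp only [Finset.mem_filter] at hi ⊢
    exact ⟨hi.1, hi.2.trans_le (node_mono σ hab)⟩
  · funext k
    obtain ⟨j, hj, e⟩ := exists_node_eq_of_subset h k
    have : (Finset.range N).filter (fun i => node τ i < node τ j) = Finset.range j := by
      ext i
      simp only [Finset.mem_filter, Finset.mem_range]
      refine ⟨fun h => lt_of_not_ge fun hji => absurd h.2 (not_lt.2 (node_mono τ hji)),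
        fun h => ⟨by omega, ?_⟩⟩
      exact (node_lt_node_succ (by omega)).trans_le (node_mono τ h)
    show node τ (n (node σ k)) = _
    rw [← e]
    simp only [n]
    rw [this, Finset.card_range]
  -- The increments of `v` starting in one step of the step function are a difference of two initial
  -- segments, hence telescope.
  · have key : ∀ k, ∑ i ∈ (Finset.range N).filter
        (fun i => node τ i ∈ Set.Ico (node σ k) (node σ (k + 1))), Δ i =
        extend v (node τ (n (node σ (k + 1)))) - extend v (node τ (n (node σ k))) := by
      intro k
      have h1 : ∀ x, ∑ i ∈ (Finset.range N).filter (fun i => node τ i < x), Δ i =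
          extend v (node τ (n x)) - extend v (node τ 0) := fun x => by
        rw [hn, Finset.sum_range_sub (fun i => extend v (node τ i))]
      rw [← sub_sub_sub_cancel_right _ _ (extend v (node τ 0)), ← h1, ← h1, eq_sub_iff_add_eq,
        ← Finset.sum_union]
      · congr 1
        ext i
        simp only [Finset.mem_union, Finset.mem_filter, Set.mem_Ico]
        have := node_mono σ (Nat.le_succ k)
        constructor
        · rintro (h | h)
          · exact ⟨h.1, h.2.2⟩
          · exact ⟨h.1, h.2.trans_le this⟩
        · intro h
          rcases lt_or_ge (node τ i) (node σ k) with h' | h'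
          · exact Or.inr ⟨h.1, h'⟩
          · exact Or.inl ⟨h.1, h', h.2⟩
      · rw [Finset.disjoint_filter]
        intro i _ h h'
        exact absurd h' (not_lt.2 h.1)
    simp only [← key, partitionSum]
    have h2 : ∀ i ∈ Finset.range N, innerL2 (extend (stepFun σ φ) (node τ i)) (Δ i) =
        ∑ k ∈ Finset.range (σ.card + 1), if node τ i ∈ Set.Ico (node σ k) (node σ (k + 1)) then
          innerL2 (φ k) (Δ i) else 0 := by
      intro i hi
      rw [extend_stepFun _ _ (node_lt_top (Finset.mem_range.1 hi)).ne, innerL2, inner_sum]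
      refine Finset.sum_congr rfl fun k _ => ?_
      by_cases h : node τ i ∈ Set.Ico (node σ k) (node σ (k + 1)) <;> simp [h, innerL2]
    rw [Finset.sum_congr rfl h2, Finset.sum_comm]
    refine Finset.sum_congr rfl fun k _ => ?_
    rw [← Finset.sum_filter, innerL2, sum_inner]
    rfl

lemma norm_innerL2_le (f g : L2) : ‖innerL2 f g‖ ≤ ‖f‖ * ‖g‖ := by
  rw [mul_comm]; exact norm_inner_le_norm g f

lemma norm_sum_innerL2_le (f g : ℕ → L2) (s : Finset ℕ) :
    ‖∑ k ∈ s, innerL2 (f k) (g k)‖ ≤ √(∑ k ∈ s, ‖f k‖ ^ 2) * √(∑ k ∈ s, ‖g k‖ ^ 2) :=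
  (norm_sum_le _ _).trans <| (Finset.sum_le_sum fun _ _ => norm_innerL2_le _ _).trans <|
    Real.sum_mul_le_sqrt_mul_sqrt _ _ _

/-- The regrouped increments lie along a monotone sequence for every `τ`, not only for refinements
of `σ`. This uniformity supplies the dominating bound for the limits. -/
lemma norm_partitionSum_stepFun_le (σ : Finset ℝ) (φ : ℕ → L2) (v : V2) (τ : Finset ℝ) :
    ‖partitionSum innerL2 (stepFun σ φ) v.toFun τ‖ ≤
      √(∑ k ∈ Finset.range (σ.card + 1), ‖φ k‖ ^ 2) * ‖v‖ := by
  obtain ⟨y, hy, -, e⟩ := exists_partitionSum_stepFun σ φ v.toFun τ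
  rw [e]
  refine (norm_sum_innerL2_le _ _ _).trans ?_
  gcongr
  exact Real.sqrt_le_left (norm_nonneg v) |>.2 (v.sum_sq_le hy _)

lemma partitionSum_stepFun_of_subset {σ τ : Finset ℝ} (φ : ℕ → L2) (v : ℝ → L2) (h : σ ⊆ τ) :
    partitionSum innerL2 (stepFun σ φ) v τ = ∑ k ∈ Finset.range (σ.card + 1),
        innerL2 (φ k) (extend v (node σ (k + 1)) - extend v (node σ k)) := by
  obtain ⟨y, -, hy, e⟩ := exists_partitionSum_stepFun σ φ v τ
  rw [e, hy h]

/-! ### The space `U²` and step functions -/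

lemma IsAtom.exists_stepFun {a : ℝ → L2} (ha : IsAtom a) : ∃ (τ : Finset ℝ) (φ : ℕ → L2),
    φ 0 = 0 ∧ ∑ k ∈ Finset.range (τ.card + 1), ‖φ k‖ ^ 2 = 1 ∧ a = stepFun τ φ := by
  obtain ⟨τ, φ, h0, h1, h⟩ := ha
  exact ⟨τ, φ, h0, h1, funext h⟩

lemma IsAtom.tendsto_atBot {a : ℝ → L2} (ha : IsAtom a) : Tendsto a atBot (𝓝 0) := by
  obtain ⟨τ, φ, h0, -, rfl⟩ := ha.exists_stepFun
  exact h0 ▸ stepFun_tendsto_atBot τ φ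

lemma stepFun_smul (τ : Finset ℝ) (φ : ℕ → L2) (c : ℂ) :
    stepFun τ (c • φ) = c • stepFun τ φ := by
  funext t
  simp only [stepFun, Pi.smul_apply, Finset.smul_sum]
  refine Finset.sum_congr rfl fun k _ => ?_
  by_cases h : (t : EReal) ∈ Set.Ico (node τ k) (node τ (k + 1)) <;> simp [h]

/-- A step function vanishing near `-∞` is a multiple of an atom. -/
lemma exists_stepFun_eq_smul (τ : Finset ℝ) {φ : ℕ → L2} (h0 : φ 0 = 0) :
    ∃ a, IsAtom a ∧
      stepFun τ φ = (√(∑ k ∈ Finset.range (τ.card + 1), ‖φ k‖ ^ 2) : ℂ) • a := by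
  set S := ∑ k ∈ Finset.range (τ.card + 1), ‖φ k‖ ^ 2 with hS
  have hS0 : 0 ≤ S := Finset.sum_nonneg fun _ _ => by positivity
  rcases hS0.eq_or_lt with h | h
  -- All values vanish, so the coefficient is zero and any atom will do.
  · obtain ⟨a, ha⟩ := exists_atom
    refine ⟨a, ha, ?_⟩
    have hz : ∀ k ∈ Finset.range (τ.card + 1), φ k = 0 := fun k hk => by
      have := (Finset.sum_eq_zero_iff_of_nonneg (fun _ _ => by positivity)).1 (hS.symm.trans h.symm)
        k hk
      simpa using this
    rw [← h]
    funext t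
    rw [stepFun, Finset.sum_eq_zero fun k hk => by simp [hz k hk]]
    simp
  · have hr : (√S : ℂ) ≠ 0 := by exact_mod_cast (Real.sqrt_pos.2 h).ne'
    refine ⟨stepFun τ ((√S : ℂ)⁻¹ • φ), ⟨τ, _, by simp [h0], ?_, fun t => rfl⟩, ?_⟩
    · simp only [Pi.smul_apply, norm_smul, mul_pow, ← Finset.mul_sum, ← hS]
      rw [norm_inv, Complex.norm_real, Real.norm_of_nonneg (Real.sqrt_nonneg _), inv_pow,
        Real.sq_sqrt hS0, inv_mul_cancel₀ h.ne']
    · rw [stepFun_smul, smul_inv_smul₀ hr]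

lemma IsAtom.isAtomicDecomposition {a : ℝ → L2} (ha : IsAtom a) (z : ℂ) :
    IsAtomicDecomposition (z • a) (Pi.single 0 z) (fun _ => a) := by
  refine ⟨fun _ => ha, ?_, fun t => ?_⟩
  · refine summable_of_ne_finset_zero (s := {0}) fun j hj => ?_
    simp [show j ≠ 0 by simpa using hj]
  · convert hasSum_single 0 fun j hj => ?_ using 1
    · simp
    · simp [hj]

/-- The element of `U²` with a given underlying function. -/
def U2.mk (u : ℝ → L2) (hu : u ∈ U2Submodule) : U2 := (⟨u, hu⟩ : ↥U2Submodule)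

lemma U2.toFun_mk (u : ℝ → L2) (hu : u ∈ U2Submodule) : (U2.mk u hu).toFun = u := rfl

lemma U2.norm_def (u : U2) : ‖u‖ = U2Norm u.toFun := rfl

lemma stepFun_mem (τ : Finset ℝ) {φ : ℕ → L2} (h0 : φ 0 = 0) : stepFun τ φ ∈ U2Submodule := by
  obtain ⟨a, ha, e⟩ := exists_stepFun_eq_smul τ h0
  exact ⟨_, _, e ▸ ha.isAtomicDecomposition _⟩

/-- A step function as an element of `U²`. -/
def U2.step (τ : Finset ℝ) (φ : ℕ → L2) (h0 : φ 0 = 0) : U2 := U2.mk _ (stepFun_mem τ h0)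

lemma U2.norm_step_le (τ : Finset ℝ) (φ : ℕ → L2) (h0 : φ 0 = 0) :
    ‖U2.step τ φ h0‖ ≤ √(∑ k ∈ Finset.range (τ.card + 1), ‖φ k‖ ^ 2) := by
  obtain ⟨a, ha, e⟩ := exists_stepFun_eq_smul τ h0
  have h := ha.isAtomicDecomposition (√(∑ k ∈ Finset.range (τ.card + 1), ‖φ k‖ ^ 2) : ℂ)
  rw [← e] at h
  refine (U2Norm_le h).trans (le_of_eq ?_)
  rw [tsum_eq_single 0 fun j hj => by simp [hj]]
  simp [abs_of_nonneg]

/-- Each atom vanishes near `-∞` because `φ 0 = 0`; the coefficients dominate the series. -/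
lemma IsAtomicDecomposition.tendsto_atBot {u : ℝ → L2} {c a} (h : IsAtomicDecomposition u c a) :
    Tendsto u atBot (𝓝 0) := by
  have e : u = fun t => ∑' j, c j • a j t := funext fun t => ((h.2.2 t).tsum_eq).symm
  have : Tendsto (fun t => ∑' j, c j • a j t) atBot (𝓝 (∑' j : ℕ, (0 : L2))) := by
    refine tendsto_tsum_of_dominated_convergence h.2.1 (fun j => ?_) (.of_forall fun t j => ?_)
    · simpa using (h.1 j).tendsto_atBot.const_smul (c j)
    · rw [norm_smul]
      exact mul_le_of_le_one_right (norm_nonneg _) ((h.1 j).norm_le t)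
  rw [e]
  simpa using this

lemma U2.tendsto_atBot (u : U2) : Tendsto u.toFun atBot (𝓝 0) := by
  obtain ⟨c, a, h⟩ := u.2
  exact h.tendsto_atBot

lemma IsAtomicDecomposition.hasSum_extend {u : ℝ → L2} {c a} (h : IsAtomicDecomposition u c a)
    (x : EReal) : HasSum (fun j => c j • extend (a j) x) (extend u x) := by
  induction x with
  | bot =>
    simp only [extend_bot h.tendsto_atBot, extend_bot (h.1 _).tendsto_atBot, smul_zero]
    exact hasSum_zero
  | coe t =>
    simp only [extend_coe]
    exact h.2.2 t
  | top =>
    simp only [extend_top, smul_zero]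
    exact hasSum_zero

lemma innerL2_smul_left (c : ℂ) (f g : L2) : innerL2 (c • f) g = c * innerL2 f g :=
  inner_smul_right ..

lemma innerL2_smul_right (c : ℂ) (f g : L2) :
    innerL2 f (c • g) = (starRingEnd ℂ) c * innerL2 f g :=
  inner_smul_left ..

lemma innerL2_add_left (f g h : L2) : innerL2 (f + g) h = innerL2 f h + innerL2 g h :=
  inner_add_right ..

lemma innerL2_add_right (f g h : L2) : innerL2 f (g + h) = innerL2 f g + innerL2 f h :=
  inner_add_left ..

lemma innerL2_sub_right (f g h : L2) : innerL2 f (g - h) = innerL2 f g - innerL2 f h :=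
  inner_sub_left ..

lemma innerL2_zero_left (g : L2) : innerL2 0 g = 0 := inner_zero_right _

lemma IsAtomicDecomposition.hasSum_partitionSum {u : ℝ → L2} {c a}
    (h : IsAtomicDecomposition u c a) (v : ℝ → L2) (τ : Finset ℝ) :
    HasSum (fun j => c j * partitionSum innerL2 (a j) v τ) (partitionSum innerL2 u v τ) := by
  simp only [partitionSum, Finset.mul_sum, ← innerL2_smul_left]
  refine hasSum_sum fun k _ => ?_
  exact (h.hasSum_extend _).mapL
    (innerSL ℂ (extend v (node τ (k + 1)) - extend v (node τ k)))

lemma IsAtom.norm_partitionSum_le {a : ℝ → L2} (ha : IsAtom a) (v : V2) (τ : Finset ℝ) :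
    ‖partitionSum innerL2 a v.toFun τ‖ ≤ ‖v‖ := by
  obtain ⟨σ, φ, -, h1, rfl⟩ := ha.exists_stepFun
  simpa [h1] using norm_partitionSum_stepFun_le σ φ v τ

lemma U2.norm_partitionSum_le (u : U2) (v : V2) (τ : Finset ℝ) :
    ‖partitionSum innerL2 u.toFun v.toFun τ‖ ≤ ‖u‖ * ‖v‖ := by
  have key : ∀ c a, IsAtomicDecomposition u.toFun c a →
      ‖partitionSum innerL2 u.toFun v.toFun τ‖ ≤ (∑' j, ‖c j‖) * ‖v‖ := by
    intro c a h
    rw [← (h.hasSum_partitionSum v.toFun τ).tsum_eq, ← tsum_mul_right]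
    refine tsum_of_norm_bounded (h.2.1.mul_right _).hasSum fun j => ?_
    rw [norm_mul]
    gcongr
    exact (h.1 j).norm_partitionSum_le v τ
  -- `‖v‖` may vanish, so the error is divided by `‖v‖ + 1`.
  have hv : 0 < ‖v‖ + 1 := by positivity
  refine le_of_forall_pos_le_add fun ε hε => ?_
  obtain ⟨c, a, h, hr⟩ := exists_lt u (div_pos hε hv)
  refine (key c a h).trans ?_
  rw [← U2.norm_def] at hr
  have h2 : ε / (‖v‖ + 1) * ‖v‖ ≤ ε := by
    rw [div_mul_eq_mul_div, div_le_iff₀ hv]; nlinarith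
  nlinarith [norm_nonneg v]

/-! ### The limit form on `U² × V²` -/

/-- The duality form of `U²` and `V²`. -/
def form (u : U2) (v : V2) : ℂ :=
  limUnder (atTop : Filter (Finset ℝ)) (partitionSum innerL2 u.toFun v.toFun)

/-- For each atom the partition sums are eventually constant, namely once its nodes are included,
and the `j`-th term is dominated by `‖c j‖ ‖v‖` for all partitions. -/
lemma tendsto_form (u : U2) (v : V2) :
    Tendsto (partitionSum innerL2 u.toFun v.toFun) atTop (𝓝 (form u v)) := by
  refine tendsto_nhds_limUnder ?_
  obtain ⟨c, a, h⟩ := u.2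
  have h' : IsAtomicDecomposition u.toFun c a := h
  choose σ φ h0 h1 e using fun j => (h'.1 j).exists_stepFun
  have he : partitionSum innerL2 u.toFun v.toFun = fun τ =>
      ∑' j, c j * partitionSum innerL2 (a j) v.toFun τ :=
    funext fun τ => (h'.hasSum_partitionSum v.toFun τ).tsum_eq.symm
  rw [he]
  refine ⟨∑' j, c j * ∑ k ∈ Finset.range ((σ j).card + 1), innerL2 (φ j k)
      (extend v.toFun (node (σ j) (k + 1)) - extend v.toFun (node (σ j) k)), ?_⟩
  refine tendsto_tsum_of_dominated_convergence (h'.2.1.mul_right ‖v‖) (fun j => ?_)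
    (.of_forall fun τ j => ?_)
  · refine Tendsto.const_mul _ (tendsto_const_nhds.congr' ?_)
    filter_upwards [eventually_ge_atTop (σ j)] with τ hτ
    rw [e j, partitionSum_stepFun_of_subset _ _ hτ]
  · rw [norm_mul]
    gcongr
    exact (h'.1 j).norm_partitionSum_le v τ

lemma norm_form_le (u : U2) (v : V2) : ‖form u v‖ ≤ ‖u‖ * ‖v‖ :=
  le_of_tendsto (tendsto_form u v).norm (.of_forall (u.norm_partitionSum_le v))

lemma form_eq_of_tendsto {u : U2} {v : V2} {z : ℂ}
    (h : Tendsto (partitionSum innerL2 u.toFun v.toFun) atTop (𝓝 z)) : form u v = z :=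
  tendsto_nhds_unique (tendsto_form u v) h

lemma form_add_left (u u' : U2) (v : V2) : form (u + u') v = form u v + form u' v := by
  refine form_eq_of_tendsto (((tendsto_form u v).add (tendsto_form u' v)).congr fun τ => ?_)
  simp only [partitionSum, map_add, extend_add ⟨_, u.tendsto_atBot⟩ ⟨_, u'.tendsto_atBot⟩,
    innerL2_add_left, Finset.sum_add_distrib]

lemma form_smul_left (c : ℂ) (u : U2) (v : V2) : form (c • u) v = c * form u v := by
  refine form_eq_of_tendsto (((tendsto_form u v).const_mul c).congr fun τ => ?_)
  simp only [partitionSum, map_smul, extend_smul c ⟨_, u.tendsto_atBot⟩,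
    innerL2_smul_left, Finset.mul_sum]

lemma form_add_right (u : U2) (v v' : V2) : form u (v + v') = form u v + form u v' := by
  refine form_eq_of_tendsto (((tendsto_form u v).add (tendsto_form u v')).congr fun τ => ?_)
  simp only [partitionSum, map_add, extend_add v.isV2.1 v'.isV2.1,
    innerL2_add_right, innerL2_sub_right, ← Finset.sum_add_distrib]
  refine Finset.sum_congr rfl fun k _ => ?_
  ring

lemma form_smul_right (c : ℂ) (u : U2) (v : V2) :
    form u (c • v) = (starRingEnd ℂ) c * form u v := by
  refine form_eq_of_tendsto (((tendsto_form u v).const_mul _).congr fun τ => ?_)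
  simp only [partitionSum, map_smul, extend_smul c v.isV2.1, ← smul_sub,
    innerL2_smul_right, Finset.mul_sum]

lemma form_step (τ : Finset ℝ) (φ : ℕ → L2) (h0 : φ 0 = 0) (v : V2) :
    form (U2.step τ φ h0) v = ∑ k ∈ Finset.range (τ.card + 1),
      innerL2 (φ k) (extend v.toFun (node τ (k + 1)) - extend v.toFun (node τ k)) := by
  refine form_eq_of_tendsto (tendsto_const_nhds.congr' ?_)
  filter_upwards [eventually_ge_atTop τ] with σ hσ
  exact (partitionSum_stepFun_of_subset φ v.toFun hσ).symm

/-! ### Variation of a functional's representative -/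

/-- The bound that a functional of norm `M` on step functions imposes on the increments of its
representative `v`. -/
def TestBound (v : ℝ → L2) (M : ℝ) : Prop :=
  ∀ (τ : Finset ℝ) (φ : ℕ → L2), φ 0 = 0 →
    ‖∑ k ∈ Finset.range (τ.card + 1),
      innerL2 (φ k) (extend v (node τ (k + 1)) - extend v (node τ k))‖ ≤
      M * √(∑ k ∈ Finset.range (τ.card + 1), ‖φ k‖ ^ 2)

lemma innerL2_self (f : L2) : innerL2 f f = ((‖f‖ ^ 2 : ℝ) : ℂ) := by
  rw [innerL2, inner_self_eq_norm_sq_to_K]; simp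

/-- Testing with the increments themselves gives `S ≤ M √S`. The increment starting at `-∞` is
missing because test functions satisfy `φ 0 = 0`. -/
lemma TestBound.sum_le {v : ℝ → L2} {M : ℝ} (h : TestBound v M) (τ : Finset ℝ) :
    ∑ k ∈ Finset.range τ.card,
      ‖extend v (node τ (k + 2)) - extend v (node τ (k + 1))‖ ^ 2 ≤ M ^ 2 := by
  set S := ∑ k ∈ Finset.range τ.card,
      ‖extend v (node τ (k + 2)) - extend v (node τ (k + 1))‖ ^ 2 with hS
  have hS0 : 0 ≤ S := Finset.sum_nonneg fun _ _ => by positivity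
  have := h τ (fun k => if k = 0 then 0 else extend v (node τ (k + 1)) - extend v (node τ k)) rfl
  simp only [Finset.sum_range_succ', Nat.add_eq_zero_iff, one_ne_zero, and_false, if_false,
    innerL2_self, if_true, innerL2_zero_left, add_zero, norm_zero] at this
  rw [← Complex.ofReal_sum] at this
  simp only [ne_eq, OfNat.ofNat_ne_zero, not_false_eq_true, zero_pow, add_zero] at this
  rw [← hS, Complex.norm_real, Real.norm_of_nonneg hS0] at this
  have h2 : √S * √S ≤ M * √S := by rwa [Real.mul_self_sqrt hS0]
  rcases (Real.sqrt_nonneg S).eq_or_lt with h3 | h3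
  · rw [eq_comm, Real.sqrt_eq_zero hS0] at h3
    rw [h3]; positivity
  · have := le_of_mul_le_mul_right h2 h3
    calc S = √S ^ 2 := (Real.sq_sqrt hS0).symm
      _ ≤ M ^ 2 := by gcongr

/-- The increment from `-∞` is recovered as a limit: a new node `t` below all others makes `v(t₁) -
v(t)` an admissible increment, and then `t → -∞`. -/
lemma TestBound.variationSum_le {v : ℝ → L2} {M : ℝ} (h : TestBound v M) (hM : 0 ≤ M)
    (hv : ∃ l, Tendsto v atBot (𝓝 l)) (τ : Finset ℝ) : variationSum v τ ≤ M := by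
  obtain ⟨l, hl⟩ := hv
  refine Real.sqrt_le_left hM |>.2 ?_
  rw [Finset.sum_range_succ']
  have hlim : Tendsto (fun t => ∑ k ∈ Finset.range τ.card,
      ‖extend v (node τ (k + 2)) - extend v (node τ (k + 1))‖ ^ 2 +
      ‖extend v (node τ 1) - v t‖ ^ 2) atBot (𝓝 (∑ k ∈ Finset.range τ.card,
      ‖extend v (node τ (k + 2)) - extend v (node τ (k + 1))‖ ^ 2 +
      ‖extend v (node τ 1) - extend v (node τ 0)‖ ^ 2)) := by
    rw [node_zero, extend_bot hl]
    exact ((hl.const_sub _).norm.pow 2).const_add _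
  refine le_of_tendsto hlim ?_
  obtain ⟨a, -, ha⟩ := EReal.lt_iff_exists_real_btwn.1
    (node_lt_node_succ (τ := τ) (k := 0) (by omega))
  filter_upwards [eventually_le_atBot a] with t ht
  have hta : (t : EReal) < node τ 1 := (EReal.coe_le_coe_iff.2 ht).trans_lt ha
  let y : ℕ → EReal := fun k => if k = 0 then ⊥ else if k = 1 then t else node τ (k - 1)
  obtain ⟨σ, hσ, hσy⟩ := exists_node_of_strictMono (n := τ.card + 1) (y := y) (by simp [y])
    (by simp [y, node_card_add_one]) (by
      intro i hi
      rcases i with _ | _ | i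
      · simp [y]
      · simpa [y] using hta
      · simpa [y] using node_lt_node_succ (τ := τ) (k := i + 1) (by omega))
  refine le_trans (le_of_eq ?_) (h.sum_le σ)
  rw [hσ, Finset.sum_range_succ', hσy (0 + 2) (by omega), hσy (0 + 1) (by omega)]
  congr 1
  · refine Finset.sum_congr rfl fun k hk => ?_
    have := Finset.mem_range.1 hk
    rw [hσy _ (by omega), hσy _ (by omega)]
    simp [y]

lemma TestBound.sum_monotone_le {v : ℝ → L2} {M : ℝ} (h : TestBound v M) {y : ℕ → ℝ}
    (hy : Monotone y) (K : ℕ) :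
    ∑ k ∈ Finset.range K, ‖v (y (k + 1)) - v (y k)‖ ^ 2 ≤ M ^ 2 := by
  obtain ⟨n, z, h0, hn, hz, hs⟩ := exists_strictMono_sum_eq (y := fun k => (y k : EReal))
    (fun _ _ hab => EReal.coe_le_coe_iff.2 (hy hab))
    (d := fun a b => ‖extend v b - extend v a‖ ^ 2) (by simp) K
  simp only [extend_coe] at hs
  rw [← hs]
  -- All points `z 0, …, z n` become interior nodes; the last increment, up to `∞`, is discarded.
  obtain ⟨σ, hσ, hσz⟩ := exists_node_of_strictMono (n := n + 1)
    (y := fun k => if k = 0 then ⊥ else if k ≤ n + 1 then z (k - 1) else ⊤) (by simp) (by simp) (by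
      intro i hi
      rcases i with _ | i
      · simp [h0]
      · rcases Nat.lt_succ_iff_lt_or_eq.1 hi with h' | h'
        · have h1 : i < n := by omega
          simpa [h1.le, Nat.succ_le_of_lt h1] using hz i h1
        · have h1 : i = n := by omega
          simp [h1, hn])
  refine le_trans ?_ (h.sum_le σ)
  rw [hσ, Finset.sum_range_succ]
  refine le_add_of_le_of_nonneg (le_of_eq (Finset.sum_congr rfl fun k hk => ?_)) (by positivity)
  have := Finset.mem_range.1 hk
  rw [hσz _ (by omega), hσz _ (by omega)]
  simp [this.le, Nat.succ_le_of_lt this]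

/-! ### Limits at `±∞` from bounded quadratic variation -/

/-- A function of bounded quadratic variation has a limit at `∞`. -/
lemma exists_tendsto_atTop_of_sum_sq_le {E : Type*} [NormedAddCommGroup E] [CompleteSpace E]
    {f : ℝ → E} {C : ℝ} (h : ∀ y : ℕ → ℝ, Monotone y → ∀ K : ℕ,
      ∑ k ∈ Finset.range K, ‖f (y (k + 1)) - f (y k)‖ ^ 2 ≤ C) :
    ∃ l, Tendsto f atTop (𝓝 l) := by
  refine cauchySeq_tendsto_of_complete (Metric.cauchySeq_iff.2 fun ε hε => ?_)
  let A : Set ℝ := {r | ∃ (y : ℕ → ℝ) (K : ℕ), Monotone y ∧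
    r = ∑ k ∈ Finset.range K, ‖f (y (k + 1)) - f (y k)‖ ^ 2}
  have hA : BddAbove A := ⟨C, by rintro r ⟨y, K, hy, rfl⟩; exact h y hy K⟩
  have hne : A.Nonempty := ⟨_, fun _ => 0, 0, monotone_const, rfl⟩
  -- Choose a sequence whose sum is within `ε²` of the supremum: appending two later times `s ≤ t`
  -- cannot gain `ε²`, so `f` oscillates by less than `ε` beyond `y K`.
  obtain ⟨_, ⟨y, K, hy, rfl⟩, hr⟩ := exists_lt_of_lt_csSup hne
    (sub_lt_self (sSup A) (pow_pos hε 2))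
  have key : ∀ s t, y K ≤ s → s ≤ t → dist (f s) (f t) < ε := by
    intro s t hs hst
    let y' : ℕ → ℝ := fun k => if k ≤ K then y k else if k = K + 1 then s else t
    have hy' : Monotone y' := by
      refine monotone_nat_of_le_succ fun n => ?_
      rcases lt_trichotomy n K with h1 | rfl | h1
      · simpa [y', h1.le, Nat.succ_le_of_lt h1] using hy (Nat.le_succ n)
      · simpa [y'] using hs
      · rcases eq_or_ne n (K + 1) with rfl | h2
        · simpa [y'] using hst
        · simp [y', h1.not_ge, h2, (h1.trans (Nat.lt_succ_self n)).not_ge, h1.ne']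
    have h1 := le_csSup hA ⟨y', K + 2, hy', rfl⟩
    rw [Finset.sum_range_succ, Finset.sum_range_succ, Finset.sum_congr rfl
      (g := fun k => ‖f (y (k + 1)) - f (y k)‖ ^ 2) fun k hk => by
        have := Finset.mem_range.1 hk
        simp [y', this.le, Nat.succ_le_of_lt this]] at h1
    have h2 : ‖f t - f s‖ ^ 2 < ε ^ 2 := by
      have h3 : y' (K + 1 + 1) = t := by simp [y']
      have h4 : y' (K + 1) = s := by simp [y']
      rw [h3, h4] at h1
      have := sq_nonneg ‖f s - f (y' K)‖
      linarith
    rw [dist_comm, dist_eq_norm]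
    exact lt_of_pow_lt_pow_left₀ 2 hε.le h2
  refine ⟨y K, fun s hs t ht => ?_⟩
  rcases le_total s t with hst | hst
  · exact key s t hs hst
  · rw [dist_comm]; exact key t s ht hst

lemma exists_tendsto_atBot_of_sum_sq_le {E : Type*} [NormedAddCommGroup E] [CompleteSpace E]
    {f : ℝ → E} {C : ℝ} (h : ∀ y : ℕ → ℝ, Monotone y → ∀ K : ℕ,
      ∑ k ∈ Finset.range K, ‖f (y (k + 1)) - f (y k)‖ ^ 2 ≤ C) :
    ∃ l, Tendsto f atBot (𝓝 l) := by
  obtain ⟨l, hl⟩ := exists_tendsto_atTop_of_sum_sq_le (f := fun t => f (-t)) (C := C) (by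
    intro y hy K
    -- Reverse time. Truncated subtraction makes the reversed sequence constant beyond `K`, so it
    -- stays monotone.
    refine le_trans (le_of_eq ?_) (h (fun k => -y (K - k))
      (fun a b hab => neg_le_neg (hy (by omega))) K)
    rw [← Finset.sum_range_reflect]
    refine Finset.sum_congr rfl fun k hk => ?_
    have := Finset.mem_range.1 hk
    rw [norm_sub_rev, show K - 1 - k + 1 = K - k by omega, show K - 1 - k = K - (k + 1) by omega])
  exact ⟨l, by simpa [Function.comp_def] using hl.comp tendsto_neg_atBot_atTop⟩

lemma TestBound.isV2 {v : ℝ → L2} {M : ℝ} (h : TestBound v M) (hM : 0 ≤ M) : IsV2 v := by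
  have hb := exists_tendsto_atBot_of_sum_sq_le (f := v) fun y hy K => h.sum_monotone_le hy K
  refine ⟨hb, exists_tendsto_atTop_of_sum_sq_le fun y hy K => h.sum_monotone_le hy K, M, ?_⟩
  rintro _ ⟨τ, rfl⟩
  exact h.variationSum_le hM hb τ

lemma TestBound.norm_le {v : V2} {M : ℝ} (h : TestBound v.toFun M) (hM : 0 ≤ M) : ‖v‖ ≤ M :=
  ciSup_le fun τ => h.variationSum_le hM v.isV2.1 τ

/-! ### Every functional on `U²` is represented by an element of `V²` -/

lemma IsAtom.mem {a : ℝ → L2} (ha : IsAtom a) : a ∈ U2Submodule :=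
  ⟨_, _, one_smul ℂ a ▸ ha.isAtomicDecomposition 1⟩

/-- The tail of an atomic decomposition is an atomic decomposition of the remainder, so partial sums
converge in the `U²` norm. -/
lemma U2.exists_tendsto (u : U2) : ∃ (c : ℕ → ℂ) (a : ℕ → U2), (∀ j, IsAtom (a j).toFun) ∧
    Tendsto (fun n => ∑ j ∈ Finset.range n, c j • a j) atTop (𝓝 u) := by
  obtain ⟨c, a, h⟩ := u.2
  have h' : IsAtomicDecomposition u.toFun c a := h
  refine ⟨c, fun j => U2.mk (a j) (h'.1 j).mem, h'.1, ?_⟩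
  rw [tendsto_iff_norm_sub_tendsto_zero]
  refine squeeze_zero (fun _ => norm_nonneg _) (fun n => ?_)
    (tendsto_sum_nat_add fun j => ‖c j‖)
  have h2 : IsAtomicDecomposition
      (u - ∑ j ∈ Finset.range n, c j • U2.mk (a j) (h'.1 j).mem).toFun
      (fun j => c (j + n)) (fun j => a (j + n)) := by
    refine ⟨fun j => h'.1 _, (summable_nat_add_iff n).2 h'.2.1, fun t => ?_⟩
    have := (hasSum_nat_add_iff' n).2 (h'.2.2 t)
    convert this using 1
    simp [U2.toFun_mk]
  rw [norm_sub_rev]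
  exact U2Norm_le h2

/-- Two bounded functionals on `U²` that agree on step functions are equal. -/
lemma U2.ext_functional {L L' : U2 →L[ℂ] ℂ}
    (h : ∀ τ φ h0, L (U2.step τ φ h0) = L' (U2.step τ φ h0)) : L = L' := by
  ext u
  obtain ⟨c, a, ha, hu⟩ := u.exists_tendsto
  refine tendsto_nhds_unique ((L.continuous.tendsto u).comp hu)
    (((L'.continuous.tendsto u).comp hu).congr fun n => ?_)
  simp only [Function.comp, map_sum, map_smul]
  refine Finset.sum_congr rfl fun j _ => ?_
  obtain ⟨τ, φ, h0, -, e⟩ := (ha j).exists_stepFun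
  rw [show a j = U2.step τ φ h0 from U2.toFun_injective e, h]

/-- `form(·, v)` as a functional. -/
def formL (v : V2) : U2 →L[ℂ] ℂ :=
  LinearMap.mkContinuous
    { toFun := fun u => form u v
      map_add' := fun u u' => form_add_left u u' v
      map_smul' := fun c u => form_smul_left c u v } ‖v‖
    (fun u => by rw [mul_comm]; exact norm_form_le u v)

lemma formL_apply (v : V2) (u : U2) : formL v u = form u v := rfl

/-- The function `χ_{[x, ∞)} f`, which belongs to `U²` for `x` real. -/
def jumpFun (x : EReal) (f : L2) (t : ℝ) : L2 := if x ≤ t then f else 0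

lemma jumpFun_coe (t : ℝ) (f : L2) :
    jumpFun t f = stepFun {t} (fun k => if k = 0 then 0 else f) := by
  have h1 : node {t} 1 = t := by
    obtain ⟨k, hk, e⟩ := exists_node_eq (Finset.mem_singleton_self t)
    obtain rfl : k = 0 := by simpa using hk
    simpa using e
  have h2 : node {t} 2 = ⊤ := by simp [node]
  funext s
  by_cases h : t ≤ s
  · simp [jumpFun, stepFun, Finset.sum_range_succ, h1, h2, h]
  · simp [jumpFun, stepFun, Finset.sum_range_succ, h1, h2, h]

lemma jumpFun_top (f : L2) : jumpFun ⊤ f = 0 := by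
  funext t; simp [jumpFun]

/-- The function `χ_{[t, ∞)} f` as an element of `U²`. -/
def U2.jump (t : ℝ) : L2 →L[ℂ] U2 :=
  LinearMap.mkContinuous
    { toFun := fun f => U2.mk (jumpFun t f) (jumpFun_coe t f ▸ stepFun_mem {t} (by simp))
      map_add' := fun f g => U2.toFun_injective (by
        rw [map_add]
        funext s
        by_cases h : t ≤ s <;> simp [U2.toFun_mk, jumpFun, h])
      map_smul' := fun c f => U2.toFun_injective (by
        rw [map_smul]
        funext s
        by_cases h : t ≤ s <;> simp [U2.toFun_mk, jumpFun, h]) } 1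
    (fun f => by
      have := U2.norm_step_le {t} (fun k => if k = 0 then 0 else f) rfl
      have e : U2.step {t} (fun k => if k = 0 then 0 else f) rfl =
        U2.mk (jumpFun t f) (jumpFun_coe t f ▸ stepFun_mem {t} (by simp)) :=
        U2.toFun_injective (jumpFun_coe t f).symm
      rw [e] at this
      simpa [Finset.sum_range_succ] using this)

/-- The indicator of `[a, b)` is that of `[a, ∞)` minus that of `[b, ∞)`. -/
lemma stepFun_eq_sum_jumpFun (τ : Finset ℝ) (φ : ℕ → L2) :
    stepFun τ φ = ∑ k ∈ Finset.range (τ.card + 1),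
      (jumpFun (node τ k) (φ k) - jumpFun (node τ (k + 1)) (φ k)) := by
  funext t
  rw [stepFun, Finset.sum_apply]
  refine Finset.sum_congr rfl fun k _ => ?_
  have := node_mono τ (Nat.le_succ k)
  simp only [Pi.sub_apply, jumpFun, Set.indicator, Set.mem_Ico]
  by_cases h1 : node τ (k + 1) ≤ t
  · simp [h1, this.trans h1, not_lt.2 h1]
  · simp [h1, not_le.1 h1]

/-- The duality `(U²)* = V²`. -/
theorem exists_form_eq (L : U2 →L[ℂ] ℂ) : ∃ v : V2, ‖v‖ ≤ ‖L‖ ∧ ∀ u, L u = form u v := by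
  -- The sign comes from `χ_{[a,b)} f = χ_{[a,∞)} f - χ_{[b,∞)} f`, which must pair to `⟨f, v(b) -
  -- v(a)⟩`.
  let v : ℝ → L2 := fun t => -(InnerProductSpace.toDual ℂ L2).symm (L ∘L U2.jump t)
  have hv : ∀ t f, innerL2 f (v t) = -L (U2.jump t f) := by
    intro t f
    rw [innerL2, inner_neg_left, InnerProductSpace.toDual_symm_apply]
    rfl
  have hstep : ∀ τ φ h0, L (U2.step τ φ h0) = ∑ k ∈ Finset.range (τ.card + 1),
      innerL2 (φ k) (extend v (node τ (k + 1)) - extend v (node τ k)) := by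
    intro τ φ h0
    -- At `⊤` the jump is zero, in accordance with the convention `v(∞) = 0`.
    have hx : ∀ x : EReal, x ≠ ⊥ → ∀ f, ∃ w : U2, w.toFun = jumpFun x f ∧
        L w = -innerL2 f (extend v x) := by
      intro x hx f
      induction x with
      | bot => exact absurd rfl hx
      | coe t => exact ⟨U2.jump t f, rfl, by rw [extend_coe, hv, neg_neg]⟩
      | top => exact ⟨0, by rw [jumpFun_top, map_zero], by simp [extend_top, innerL2]⟩
    have hk : ∀ k ∈ Finset.range (τ.card + 1), ∃ w : U2,
        w.toFun = jumpFun (node τ k) (φ k) - jumpFun (node τ (k + 1)) (φ k) ∧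
        L w = innerL2 (φ k) (extend v (node τ (k + 1)) - extend v (node τ k)) := by
      intro k hk
      rcases Nat.eq_zero_or_pos k with rfl | hk0
      -- The first step begins at `-∞`, where no jump in `U²` is at hand; `φ 0 = 0` removes it.
      · refine ⟨0, ?_, by simp [h0, innerL2]⟩
        rw [map_zero, h0]
        funext t
        simp [jumpFun]
      · have hne : ∀ j, 0 < j → j ≤ τ.card + 1 → node τ j ≠ ⊥ := by
          intro j hj hj'
          obtain ⟨i, rfl⟩ := Nat.exists_eq_succ_of_ne_zero hj.ne'
          exact (bot_le.trans_lt (node_lt_node_succ (by omega))).ne'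
        have hk' := Finset.mem_range.1 hk
        obtain ⟨w, hw, hL⟩ := hx _ (hne k hk0 (by omega)) (φ k)
        obtain ⟨w', hw', hL'⟩ := hx _ (hne (k + 1) (by omega) (by omega)) (φ k)
        refine ⟨w - w', by rw [map_sub, hw, hw'], ?_⟩
        rw [map_sub, hL, hL', innerL2_sub_right]
        ring
    choose! w hw hLw using hk
    have e : U2.step τ φ h0 = ∑ k ∈ Finset.range (τ.card + 1), w k := by
      refine U2.toFun_injective ?_
      rw [map_sum, Finset.sum_congr rfl hw]
      exact stepFun_eq_sum_jumpFun τ φ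
    rw [e, map_sum, Finset.sum_congr rfl hLw]
  have hb : TestBound v ‖L‖ := fun τ φ h0 => by
    rw [← hstep τ φ h0]
    refine (L.le_opNorm _).trans ?_
    gcongr
    exact U2.norm_step_le τ φ h0
  let V : V2 := (⟨v, hb.isV2 (norm_nonneg _)⟩ : ↥V2Submodule)
  refine ⟨V, TestBound.norm_le (v := V) hb (norm_nonneg _), fun u => ?_⟩
  have : L = formL V := U2.ext_functional fun τ φ h0 => by
    rw [hstep, formL_apply, form_step]
    rfl
  rw [this, formL_apply]

/-- The increments of `v` pass the test bound with constant `0`, so the `V²` norm is zero. -/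
lemma V2.eq_zero_of_form (v : V2) (h : ∀ u, form u v = 0) : v = 0 := by
  have hb : TestBound v.toFun 0 := fun τ φ h0 => by
    rw [← form_step τ φ h0, h]
    simp
  exact norm_le_zero_iff.1 (hb.norm_le le_rfl)

/-! ### Synthesis of a distribution from its frequency blocks -/

/-- `1 + ω²`, where `ω = 2πξ` is the angular frequency. -/
def symb (ξ : ℝ) : ℝ := 1 + (2 * Real.pi * ξ) ^ 2

/-- The step function `1 + k²` on the angular frequencies that round to `k`. -/
def stepSymb (ξ : ℝ) : ℝ := 1 + (round (2 * Real.pi * ξ) : ℝ) ^ 2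

lemma symb_pos (ξ : ℝ) : 0 < symb ξ := by unfold symb; positivity

lemma stepSymb_pos (ξ : ℝ) : 0 < stepSymb ξ := by unfold stepSymb; positivity

lemma stepSymb_le (ξ : ℝ) : stepSymb ξ ≤ 2 * symb ξ := by
  unfold stepSymb symb
  have := abs_le.1 (abs_sub_round (2 * Real.pi * ξ))
  set x := 2 * Real.pi * ξ
  -- With `r = round x`: `2x² + 2(x - r)² - r² = (2x - r)²` and `|x - r| ≤ 1/2`.
  nlinarith [sq_nonneg (2 * x - round x), mul_nonneg (sub_nonneg.2 this.1) (sub_nonneg.2 this.2)]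

lemma measurable_stepSymb : Measurable stepSymb := by
  have : Measurable fun ξ : ℝ => round (2 * Real.pi * ξ) := by
    simp only [round_eq]
    exact Int.measurable_floor.comp (by fun_prop)
  have h2 : Measurable fun k : ℤ => 1 + (k : ℝ) ^ 2 := measurable_of_countable _
  exact h2.comp this

lemma continuous_symb : Continuous symb := by unfold symb; fun_prop

/-- The bounded Fourier multiplier that compares the step function with the smooth symbol. -/
def ratio (m : ℕ) (ξ : ℝ) : ℂ := ((stepSymb ξ / symb ξ) ^ m : ℝ)

lemma memLp_ratio (m : ℕ) : MemLp (ratio m) ⊤ (volume : Measure ℝ) := by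
  refine memLp_top_of_bound ?_ (2 ^ m) (.of_forall fun ξ => ?_)
  · exact (Complex.measurable_ofReal.comp
      ((measurable_stepSymb.div continuous_symb.measurable).pow_const m)).aestronglyMeasurable
  · have := stepSymb_pos ξ
    have := symb_pos ξ
    rw [ratio, Complex.norm_real, Real.norm_of_nonneg (by positivity)]
    gcongr
    rw [div_le_iff₀ (by positivity)]
    exact stepSymb_le ξ

/-- `(1 + ω²)^m` -/
def smoothSymb (m : ℕ) (ξ : ℝ) : ℂ := (1 + (2 * Real.pi * ξ : ℝ) ^ 2) ^ m

lemma smoothSymb_eq (m : ℕ) (ξ : ℝ) : smoothSymb m ξ = (symb ξ ^ m : ℝ) := by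
  simp [smoothSymb, symb]

lemma hasTemperateGrowth_smoothSymb (m : ℕ) : (smoothSymb m).HasTemperateGrowth := by
  have h : Function.HasTemperateGrowth (fun ξ : ℝ => ((2 * Real.pi * ξ : ℝ) : ℂ)) := by fun_prop
  exact ((Function.HasTemperateGrowth.const 1).add (h.pow 2)).pow m

/-- The distribution whose Fourier transform is `(1 + k²)^m 𝓕 h` on the band `k`. -/
def synthDist (m : ℕ) : L2 →L[ℂ] 𝓢'(ℝ, ℂ) :=
  -- The multiplier `stepSymb ^ m` is discontinuous and cannot act on distributions directly. It is
  -- split into the bounded factor `ratio m`, acting on `L²`, and the smooth factor of temperate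
  -- growth, acting on distributions.
  fourierInvCLM ℂ 𝓢'(ℝ, ℂ) ∘L TemperedDistribution.smulLeftCLM ℂ (smoothSymb m) ∘L
    Lp.toTemperedDistributionCLM ℂ volume 2 ∘L
    (ContinuousLinearMap.lsmul ℂ ℂ).holderL volume ⊤ 2 2 (memLp_ratio m).toLp ∘L fourierCLM ℂ L2

/-- The multiplier moves onto the Schwartz function, where it preserves the Schwartz class; the
pairing with `g` is then a product of two `L²` functions. -/
lemma isFourier_of_fourier_eq_smul {f : 𝓢'(ℝ, ℂ)} {F : ℝ → ℂ} {g : L2} {p : ℝ → ℂ}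
    (hp : p.HasTemperateGrowth) (hF : F =ᵐ[volume] fun ξ => p ξ * g ξ)
    (h : 𝓕 f = TemperedDistribution.smulLeftCLM ℂ p (Lp.toTemperedDistribution g)) :
    IsFourier f F := by
  constructor
  · intro K hK
    obtain ⟨C, hC⟩ := hK.exists_bound_of_continuousOn hp.1.continuous.continuousOn
    have hg : MemLp g 2 (volume.restrict K) := (Lp.memLp g).restrict K
    refine MemLp.ae_eq (EventuallyEq.symm (ae_restrict_of_ae hF)) (hg.of_le_mul (c := C) ?_ ?_)
    · exact hp.1.continuous.aestronglyMeasurable.mul hg.1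
    · filter_upwards [ae_restrict_mem hK.measurableSet] with ξ hξ
      rw [norm_mul]
      gcongr
      exact hC ξ hξ
  · intro φ
    have e : (fun ξ => φ ξ • F ξ) =ᵐ[volume]
        fun ξ => (SchwartzMap.smulLeftCLM ℂ p φ) ξ • g ξ := by
      filter_upwards [hF] with ξ hξ
      rw [hξ, SchwartzMap.smulLeftCLM_apply_apply hp]
      simp only [smul_eq_mul]
      ring
    constructor
    · refine Integrable.congr ?_ e.symm
      exact ((SchwartzMap.smulLeftCLM ℂ p φ).memLp 2 volume).integrable_mul (Lp.memLp g)
    · rw [h, TemperedDistribution.smulLeftCLM_apply_apply, Lp.toTemperedDistribution_apply,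
        integral_congr_ae e]

lemma isFourier_synthDist (m : ℕ) (h : L2) :
    IsFourier (synthDist m h) (fun ξ => ((stepSymb ξ ^ m : ℝ) : ℂ) * (𝓕 h : L2) ξ) := by
  refine isFourier_of_fourier_eq_smul (hasTemperateGrowth_smoothSymb m)
    (g := (ContinuousLinearMap.lsmul ℂ ℂ).holderL volume ⊤ 2 2 (memLp_ratio m).toLp (𝓕 h)) ?_ ?_
  · filter_upwards [(ContinuousLinearMap.lsmul ℂ ℂ).coeFn_holder (r := 2) (memLp_ratio m).toLp
      (𝓕 h : L2), (memLp_ratio m).coeFn_toLp] with ξ h1 h2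
    refine Eq.trans ?_ (congrArg _ h1.symm)
    rw [h2, ContinuousLinearMap.lsmul_apply, smoothSymb_eq, ratio, smul_eq_mul, ← mul_assoc,
      ← Complex.ofReal_mul, ← mul_pow, mul_div_cancel₀ _ (symb_pos ξ).ne']
  · exact FourierTransform.fourier_fourierInv_eq _

/-- `synthDist` with values in the distributions with locally square integrable Fourier
transform. -/
def synth (m : ℕ) : L2 →L[ℂ] FourierL2loc :=
  (synthDist m).codRestrict FourierL2loc fun h => ⟨_, isFourier_synthDist m h⟩

/-! ### The frequency blocks -/

lemma measurableSet_band (k : ℤ) : MeasurableSet (band k) := by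
  rw [band_eq]; exact measurableSet_Icc

lemma fourier_box_ae_eq {f : FourierL2loc} {F : ℝ → ℂ} (hF : IsFourier f.1 F) (k : ℤ) :
    (𝓕 (box k f) : L2) =ᵐ[volume] (band k).indicator F := by
  have h : (𝓕 (box k f) : L2) = (memLp_band k f).toLp :=
    FourierTransform.fourier_fourierInv_eq _
  rw [h]
  refine (memLp_band k f).coeFn_toLp.trans ?_
  filter_upwards [(fhat_spec f).ae_eq hF] with ξ hξ
  by_cases hk : ξ ∈ band k <;> simp [hk, hξ]

lemma L2.ext_fourier {f g : L2} (h : (𝓕 f : L2) =ᵐ[volume] (𝓕 g : L2)) : f = g := by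
  have h' : 𝓕 f = 𝓕 g := Lp.ext h
  have := congrArg (fun w : L2 => (𝓕⁻ w : L2)) h'
  simpa only [FourierTransform.fourierInv_fourier_eq] using this

lemma synth_spec (m : ℕ) (h : L2) :
    IsFourier (synth m h).1 (fun ξ => ((stepSymb ξ ^ m : ℝ) : ℂ) * (𝓕 h : L2) ξ) :=
  isFourier_synthDist m h

lemma fourier_box_synth_zero (k : ℤ) (h : L2) :
    (𝓕 (box k (synth 0 h)) : L2) =ᵐ[volume] (band k).indicator (𝓕 h : L2) := by
  simpa using fourier_box_ae_eq (synth_spec 0 h) k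

/-- `□_k` on `L²`. -/
def bandProj (k : ℤ) : L2 →L[ℂ] L2 :=
  -- `synth 0` has multiplier `1`, so it embeds `L²` in the distributions; the bound is Plancherel.
  LinearMap.mkContinuous (box k ∘ₗ (synth 0).toLinearMap) 1 fun h => by
    rw [one_mul, LinearMap.comp_apply, ← Lp.norm_fourier_eq, ← Lp.norm_fourier_eq h]
    refine Lp.norm_le_norm_of_ae_le ?_
    filter_upwards [fourier_box_synth_zero k h] with ξ hξ
    refine (congrArg norm hξ).trans_le ?_
    exact norm_indicator_le_norm_self _ _

lemma bandProj_apply (k : ℤ) (h : L2) : bandProj k h = box k (synth 0 h) := rfl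

lemma norm_bandProj_le (k : ℤ) (h : L2) : ‖bandProj k h‖ ≤ ‖h‖ := by
  simpa using (bandProj k).le_of_opNorm_le (LinearMap.mkContinuous_norm_le _ zero_le_one _) h

lemma fourier_bandProj (k : ℤ) (h : L2) :
    (𝓕 (bandProj k h) : L2) =ᵐ[volume] (band k).indicator (𝓕 h : L2) :=
  fourier_box_synth_zero k h

/-- Only the right end of the closed band rounds to `k + 1`. This makes the bands disjoint up to
null sets and `stepSymb` constant a.e. on each. -/
lemma ae_round_eq (k : ℤ) : ∀ᵐ ξ : ℝ, ξ ∈ band k → round (2 * Real.pi * ξ) = k := by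
  have h : ∀ᵐ ξ : ℝ, ξ ≠ (k + 1 / 2) / (2 * Real.pi) := by
    simp [ae_iff]
  filter_upwards [h] with ξ hξ hk
  rw [round_eq_iff]
  refine ⟨hk.1, hk.2.lt_of_ne fun h => hξ ?_⟩
  rw [eq_div_iff Real.two_pi_pos.ne', mul_comm, h]

lemma box_synth (m : ℕ) (k : ℤ) (h : L2) :
    box k (synth m h) = (((1 + (k : ℝ) ^ 2) ^ m : ℝ) : ℂ) • bandProj k h := by
  refine L2.ext_fourier ?_
  rw [FourierTransform.fourier_smul]
  filter_upwards [fourier_box_ae_eq (synth_spec m h) k, fourier_bandProj k h, ae_round_eq k,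
    Lp.coeFn_smul (((1 + (k : ℝ) ^ 2) ^ m : ℝ) : ℂ) (𝓕 (bandProj k h) : L2)] with ξ h1 h2 h3 h4
  rw [h1, h4, Pi.smul_apply, h2]
  by_cases hk : ξ ∈ band k
  · simp [hk, stepSymb, h3 hk]
  · simp [hk]

lemma bandProj_box_self (k : ℤ) (f : FourierL2loc) : bandProj k (box k f) = box k f := by
  refine L2.ext_fourier ?_
  filter_upwards [fourier_bandProj k (box k f), fourier_box_ae_eq (fhat_spec f) k] with ξ h1 h2
  rw [h1]
  by_cases hk : ξ ∈ band k <;> simp [hk, h2]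

lemma bandProj_box_of_ne {j k : ℤ} (hjk : j ≠ k) (f : FourierL2loc) :
    bandProj j (box k f) = 0 := by
  refine L2.ext_fourier ?_
  have h0 : (𝓕 (0 : L2) : L2) = 0 := FourierTransform.fourier_zero
  rw [h0]
  filter_upwards [fourier_bandProj j (box k f), fourier_box_ae_eq (fhat_spec f) k, ae_round_eq j,
    ae_round_eq k, Lp.coeFn_zero ℂ 2 (volume : Measure ℝ)] with ξ h1 h2 h3 h4 h5
  rw [h1, h5]
  by_cases hj : ξ ∈ band j
  · have hk : ξ ∉ band k := fun hk => hjk ((h3 hj).symm.trans (h4 hk))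
    simp [hj, h2, hk]
  · simp [hj]

lemma innerL2_bandProj (k : ℤ) (f g : L2) :
    innerL2 (bandProj k f) (bandProj k g) =
      ∫ ξ in band k, inner ℂ ((𝓕 g : L2) ξ) ((𝓕 f : L2) ξ) := by
  rw [innerL2, ← Lp.inner_fourier_eq, L2.inner_def, ← integral_indicator (measurableSet_band k)]
  refine integral_congr_ae ?_
  filter_upwards [fourier_bandProj k f, fourier_bandProj k g] with ξ h1 h2
  rw [h1, h2]
  by_cases hk : ξ ∈ band k <;> simp [hk]

lemma innerL2_bandProj_left (k : ℤ) (f g : L2) :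
    innerL2 (bandProj k f) g = innerL2 f (bandProj k g) := by
  rw [innerL2, innerL2, ← Lp.inner_fourier_eq, ← Lp.inner_fourier_eq (bandProj k g), L2.inner_def, L2.inner_def]
  refine integral_congr_ae ?_
  filter_upwards [fourier_bandProj k f, fourier_bandProj k g] with ξ h1 h2
  rw [h1, h2]
  by_cases hk : ξ ∈ band k <;> simp [hk]

lemma iUnion_band : ⋃ k, band k = Set.univ := by
  refine Set.eq_univ_of_forall fun ξ => Set.mem_iUnion.2 ⟨round (2 * Real.pi * ξ), ?_⟩
  have := abs_le.1 (abs_sub_round (2 * Real.pi * ξ))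
  exact ⟨by linarith [this.1], by linarith [this.2]⟩

/-- By Plancherel this is countable additivity of the integral over the bands, which cover the line
and are a.e. disjoint. -/
lemma hasSum_innerL2_bandProj (f g : L2) :
    HasSum (fun k => innerL2 (bandProj k f) (bandProj k g)) (innerL2 f g) := by
  have h := hasSum_integral_iUnion_ae (μ := (volume : Measure ℝ)) (s := band)
    (f := fun ξ => inner ℂ ((𝓕 g : L2) ξ) ((𝓕 f : L2) ξ))
    (fun k => (measurableSet_band k).nullMeasurableSet) (fun j k hjk => ?_) ?_
  · simp only [innerL2_bandProj]
    rw [iUnion_band, setIntegral_univ, ← L2.inner_def, Lp.inner_fourier_eq] at h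
    exact h
  · rw [Function.onFun, AEDisjoint, measure_eq_zero_iff_ae_notMem]
    filter_upwards [ae_round_eq j, ae_round_eq k] with ξ h1 h2 h3
    exact hjk ((h1 h3.1).symm.trans (h2 h3.2))
  · exact (L2.integrable_inner _ _).integrableOn

/-! ### Convergence of distributions whose frequency blocks converge -/

lemma one_le_bracket (k : ℤ) : 1 ≤ √(1 + (k : ℝ) ^ 2) := by
  rw [Real.one_le_sqrt]; nlinarith [sq_nonneg (k : ℝ)]

lemma weight_pos (s : ℝ) (k : ℤ) : 0 < weight s k := by unfold weight; positivity

lemma weight_le (r : ℝ) (k : ℤ) : weight r k ≤ (1 + (k : ℝ) ^ 2) ^ ⌈|r|⌉₊ := by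
  have h := one_le_bracket k
  calc weight r k ≤ √(1 + (k : ℝ) ^ 2) ^ ((2 * ⌈|r|⌉₊ : ℕ) : ℝ) := by
        refine Real.rpow_le_rpow_of_exponent_le h ?_
        push_cast
        have := Nat.le_ceil |r|
        have := le_abs_self r
        have := abs_nonneg r
        linarith
    _ = _ := by
        rw [Real.rpow_natCast, pow_mul, Real.sq_sqrt (by positivity)]

lemma summable_inv_one_add_sq : Summable fun k : ℤ => (1 + (k : ℝ) ^ 2)⁻¹ := by
  refine Summable.of_nonneg_of_le (fun k => by positivity) (fun k => ?_)
    ((Real.summable_one_div_int_pow.2 one_lt_two).add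
      (summable_of_ne_finset_zero (f := fun k : ℤ => if k = 0 then (1 : ℝ) else 0) (s := {0})
        (by simp +contextual)))
  by_cases hk : k = 0
  · simp [hk]
  · have : (0 : ℝ) < (k : ℝ) ^ 2 := by positivity
    simp only [hk, if_false, add_zero, one_div]
    gcongr
    linarith

/-- The regularized sum of the frequency blocks. -/
def blockTerm (m : ℕ) (h : ℤ → L2) (k : ℤ) : L2 := ((((1 + (k : ℝ) ^ 2) ^ m)⁻¹ : ℝ) : ℂ) • h k

/-- `⌈|r|⌉₊` powers of the damping absorb the weight; the additional one makes the sum over `k`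
converge. -/
lemma norm_blockTerm_le {r C : ℝ} {h : ℤ → L2} {k : ℤ} (hC : ‖h k‖ ≤ C * weight r k)
    (hC0 : 0 ≤ C) : ‖blockTerm (⌈|r|⌉₊ + 1) h k‖ ≤ C * (1 + (k : ℝ) ^ 2)⁻¹ := by
  have hp : 0 < 1 + (k : ℝ) ^ 2 := by positivity
  rw [blockTerm, norm_smul, Complex.norm_real, Real.norm_of_nonneg (by positivity)]
  calc _ ≤ ((1 + (k : ℝ) ^ 2) ^ (⌈|r|⌉₊ + 1))⁻¹ * (C * (1 + (k : ℝ) ^ 2) ^ ⌈|r|⌉₊) := by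
        gcongr
        exact hC.trans (by gcongr; exact weight_le r k)
    _ = _ := by field_simp; ring

/-- The damped blocks are summable in `L²`, and on the band `k` the multiplier of `synth` undoes the
damping exactly. -/
lemma exists_box_eq {r C : ℝ} (hC0 : 0 ≤ C) {h : ℤ → L2} (hC : ∀ k, ‖h k‖ ≤ C * weight r k)
    (hb : ∀ k, bandProj k (h k) = h k) :
    ∀ k, box k (synth (⌈|r|⌉₊ + 1) (∑' j, blockTerm (⌈|r|⌉₊ + 1) h j)) = h k := by
  intro k
  have hs : Summable (blockTerm (⌈|r|⌉₊ + 1) h) :=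
    Summable.of_norm_bounded (summable_inv_one_add_sq.mul_left C)
      fun k => norm_blockTerm_le (hC k) hC0
  rw [box_synth, (bandProj k).map_tsum hs, tsum_eq_single k]
  · rw [blockTerm, map_smul, hb, smul_smul, ← Complex.ofReal_mul, mul_inv_cancel₀ (by positivity)]
    simp
  · intro j hj
    rw [blockTerm, map_smul, ← hb j, bandProj_apply j, bandProj_box_of_ne hj.symm, smul_zero]

/-- A common polynomial bound on the blocks upgrades blockwise convergence to convergence of the
damped sums in `L²`, and `synth` is continuous. This is what computes values at `-∞` block by block.
-/
lemma exists_tendsto_of_box {α : Type*} {l : Filter α} [l.NeBot] {f : α → FourierL2loc}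
    {r C : ℝ} (hC0 : 0 ≤ C) (hC : ∀ a k, ‖box k (f a)‖ ≤ C * weight r k) {h : ℤ → L2}
    (hf : ∀ k, Tendsto (fun a => box k (f a)) l (𝓝 (h k))) :
    ∃ w, Tendsto f l (𝓝 w) ∧ ∀ k, box k w = h k := by
  let m := ⌈|r|⌉₊ + 1
  have hh : ∀ k, ‖h k‖ ≤ C * weight r k := fun k =>
    le_of_tendsto (hf k).norm (.of_forall fun a => hC a k)
  have hb : ∀ k, bandProj k (h k) = h k := fun k =>
    tendsto_nhds_unique (((bandProj k).continuous.tendsto _).comp (hf k))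
      ((hf k).congr fun a => (bandProj_box_self k (f a)).symm)
  refine ⟨synth m (∑' j, blockTerm m h j), ?_, exists_box_eq hC0 hh hb⟩
  -- A distribution is determined by its blocks, so each `f a` is its own synthesis.
  have e : ∀ a, f a = synth m (∑' j, blockTerm m (fun k => box k (f a)) j) := fun a => by
    rw [← sub_eq_zero]
    refine eq_zero_of_box _ fun k => ?_
    rw [map_sub, exists_box_eq hC0 (hC a) (fun k => bandProj_box_self k (f a)), sub_self]
  rw [show f = fun a => synth m (∑' j, blockTerm m (fun k => box k (f a)) j) from funext e]
  refine ((synth m).continuous.tendsto _).comp ?_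
  exact tendsto_tsum_of_dominated_convergence (summable_inv_one_add_sq.mul_left C)
    (fun k => (hf k).const_smul _) (.of_forall fun a k => norm_blockTerm_le (hC a k) hC0)

lemma isFourier_toTemperedDistribution (h : L2) :
    IsFourier (Lp.toTemperedDistribution h) (𝓕 h : L2) := by
  refine isFourier_of_fourier_eq_smul (p := fun _ => 1) (.const 1) (g := (𝓕 h : L2))
    (.of_forall fun ξ => by simp) ?_
  rw [TemperedDistribution.smulLeftCLM_const, one_smul]
  exact Lp.fourier_toTemperedDistribution_eq h

lemma box_of_eq_toTemperedDistribution {f : FourierL2loc} {h : L2}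
    (hf : (f : 𝓢'(ℝ, ℂ)) = Lp.toTemperedDistribution h) (k : ℤ) : box k f = bandProj k h := by
  refine L2.ext_fourier ?_
  exact (fourier_box_ae_eq (hf ▸ isFourier_toTemperedDistribution h) k).trans
    (fourier_bandProj k h).symm

/-! ### Duality of weighted sequence spaces -/

section Sequences

variable {q q' : ℝ≥0∞}

lemma eq_one_of_holderConjugate_top (h : q.HolderConjugate ⊤) : q = 1 := by
  have := ENNReal.HolderConjugate.inv_add_inv_eq_one q ⊤
  simpa using this

lemma lp_hoelder {E F : Type*} [NormedAddCommGroup E] [NormedAddCommGroup F]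
    (hq : q ≠ ⊤) (hqq' : q.HolderConjugate q') (f : lp (fun _ : ℤ => E) q)
    (g : lp (fun _ : ℤ => F) q') :
    (Summable fun k => ‖f k‖ * ‖g k‖) ∧ ∑' k, ‖f k‖ * ‖g k‖ ≤ ‖f‖ * ‖g‖ := by
  by_cases hq' : q' = ⊤
  · subst hq'
    obtain rfl := eq_one_of_holderConjugate_top hqq'
    have h1 : HasSum (fun k => ‖f k‖) ‖f‖ := by
      simpa using lp.hasSum_norm (p := 1) (by simp) f
    have hle : ∀ k, ‖f k‖ * ‖g k‖ ≤ ‖f k‖ * ‖g‖ := fun k => by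
      gcongr
      exact lp.norm_apply_le_norm ENNReal.top_ne_zero g k
    have hs : Summable fun k => ‖f k‖ * ‖g k‖ :=
      Summable.of_nonneg_of_le (fun _ => by positivity) hle (h1.summable.mul_right _)
    exact ⟨hs, hasSum_le hle hs.hasSum (h1.mul_right _)⟩
  · have := ENNReal.HolderConjugate.toReal_of_ne_top (p := q) (q := q') hq hq'
    have h := lp.tsum_mul_le_mul_norm this (lp.toNorm f) (lp.toNorm g)
    rw [lp.norm_toNorm, lp.norm_toNorm] at h
    simpa using h

/-- A sequence of norms that is bounded when tested against `ℓ^q` belongs to `ℓ^{q'}`. -/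
lemma exists_memℓp_of_test {E : Type*} [NormedAddCommGroup E] (hq : q ≠ ⊤)
    (hqq' : q.HolderConjugate q') {g : ℤ → E} {M : ℝ} (hM : 0 ≤ M)
    (h : ∀ (s : Finset ℤ) (b : ℤ → NNReal), ∑ k ∈ s, b k ^ q.toReal ≤ 1 →
      ∑ k ∈ s, ‖g k‖ * b k ≤ M) :
    ∃ hg : Memℓp g q', ‖(⟨g, hg⟩ : lp (fun _ : ℤ => E) q')‖ ≤ M := by
  by_cases hq' : q' = ⊤
  · subst hq'
    have hle : ∀ k, ‖g k‖ ≤ M := fun k => by simpa using h {k} (fun _ => 1) (by simp)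
    exact ⟨memℓp_infty ⟨M, by rintro _ ⟨k, rfl⟩; exact hle k⟩, lp.norm_le_of_forall_le hM hle⟩
  · have hc := (ENNReal.HolderConjugate.toReal_of_ne_top (p := q) (q := q') hq hq').symm
    have hs : ∀ s : Finset ℤ, ∑ k ∈ s, ‖g k‖ ^ q'.toReal ≤ M ^ q'.toReal := by
      intro s
      -- On a finite set the `ℓ^{q'}` norm is attained by a sequence `b` in the unit ball of `ℓ^q`.
      obtain ⟨b, hb, e⟩ := (NNReal.isGreatest_Lp s (fun k => ‖g k‖₊) hc).1
      have h1 := h s b hb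
      have h2 : ((∑ k ∈ s, ‖g k‖₊ ^ q'.toReal) ^ (1 / q'.toReal) : NNReal) ≤ M.toNNReal := by
        rw [← e, ← NNReal.coe_le_coe, Real.coe_toNNReal _ hM]
        simpa using h1
      rw [one_div, NNReal.rpow_inv_le_iff hc.pos, ← NNReal.coe_le_coe] at h2
      simpa [hM] using h2
    exact ⟨memℓp_gen' hs, lp.norm_le_of_forall_sum_le hc.pos hM hs⟩

end Sequences

/-- The norm of `L` need not be attained, whence `θ < 1`; multiplication by a phase makes the value
real. -/
lemma exists_apply_eq_real {E : Type*} [NormedAddCommGroup E] [NormedSpace ℂ E] (L : E →L[ℂ] ℂ)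
    {θ : ℝ} (hθ : θ < 1) : ∃ (g : E) (r : ℝ), ‖g‖ ≤ 1 ∧ L g = r ∧ θ * ‖L‖ ≤ r := by
  rcases (norm_nonneg L).eq_or_lt with h | h
  · exact ⟨0, 0, by simp, by simp, by simp [← h]⟩
  · obtain ⟨g, hg, hr⟩ := L.exists_lt_apply_of_lt_opNorm
      (show θ * ‖L‖ < ‖L‖ from mul_lt_of_lt_one_left h hθ)
    refine ⟨((starRingEnd ℂ) (L g) / ‖L g‖) • g, ‖L g‖, ?_, ?_, hr.le⟩
    · rw [norm_smul, norm_div, RCLike.norm_conj, Complex.norm_real, norm_norm]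
      exact mul_le_one₀ (div_self_le_one _) (norm_nonneg _) hg.le
    · rw [map_smul, smul_eq_mul, div_mul_eq_mul_div, mul_comm, Complex.mul_conj,
        Complex.normSq_eq_norm_sq]
      push_cast
      rw [pow_two, mul_self_div_self]

/-! ### The action of contractions of `L²` on `U²` and `V²` -/

section Contraction

variable (P : L2 →L[ℂ] L2) (hP : ∀ f, ‖P f‖ ≤ ‖f‖)

/-- The image is a step function with the same nodes and smaller values, hence an atom times a
factor of modulus at most `1`. -/
lemma IsAtom.exists_map (P : L2 →L[ℂ] L2) (hP : ∀ f, ‖P f‖ ≤ ‖f‖) {a : ℝ → L2} (ha : IsAtom a) :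
    ∃ (z : ℂ) (a' : ℝ → L2), ‖z‖ ≤ 1 ∧ IsAtom a' ∧ (fun t => P (a t)) = z • a' := by
  obtain ⟨τ, φ, h0, h1, rfl⟩ := ha.exists_stepFun
  obtain ⟨a', ha', e⟩ := exists_stepFun_eq_smul τ (φ := fun k => P (φ k)) (by simp [h0])
  refine ⟨_, a', ?_, ha', Eq.trans (funext fun t => ?_) e⟩
  · rw [Complex.norm_real, Real.norm_of_nonneg (Real.sqrt_nonneg _), Real.sqrt_le_left zero_le_one,
      one_pow]
    refine le_trans (Finset.sum_le_sum fun k _ => ?_) h1.le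
    gcongr
    exact hP _
  · simp only [stepFun, map_sum]
    refine Finset.sum_congr rfl fun k _ => ?_
    by_cases h : (t : EReal) ∈ Set.Ico (node τ k) (node τ (k + 1)) <;> simp [h]

lemma IsAtomicDecomposition.exists_map (P : L2 →L[ℂ] L2) (hP : ∀ f, ‖P f‖ ≤ ‖f‖)
    {u : ℝ → L2} {c a} (h : IsAtomicDecomposition u c a) :
    ∃ c' a', IsAtomicDecomposition (fun t => P (u t)) c' a' ∧ ∑' j, ‖c' j‖ ≤ ∑' j, ‖c j‖ := by
  choose z a' hz ha' e using fun j => (h.1 j).exists_map P hP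
  have hle : ∀ j, ‖c j * z j‖ ≤ ‖c j‖ := fun j => by
    rw [norm_mul]; exact mul_le_of_le_one_right (norm_nonneg _) (hz j)
  have hs : Summable fun j => ‖c j * z j‖ := h.2.1.of_nonneg_of_le (fun _ => norm_nonneg _) hle
  refine ⟨fun j => c j * z j, a', ⟨ha', hs, fun t => ?_⟩, hs.tsum_le_tsum hle h.2.1⟩
  convert (h.2.2 t).mapL P using 2 with j
  rw [map_smul, mul_smul]
  congr 1
  exact (congrFun (e j) t).symm

/-- The action of a contraction on `U²`. -/
def U2.map : U2 →L[ℂ] U2 :=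
  LinearMap.mkContinuous
    { toFun := fun u => U2.mk (fun t => P (u.toFun t)) (by
        obtain ⟨c, a, h⟩ := u.2
        obtain ⟨c', a', h', -⟩ := IsAtomicDecomposition.exists_map P hP h
        exact ⟨c', a', h'⟩)
      map_add' := fun u u' => U2.toFun_injective (funext fun t => by
        simp [U2.toFun_mk])
      map_smul' := fun c u => U2.toFun_injective (funext fun t => by
        simp [U2.toFun_mk]) } 1
    (fun u => by
      rw [one_mul]
      refine le_of_forall_pos_le_add fun ε hε => ?_
      obtain ⟨c, a, h, hr⟩ := exists_lt u hε
      obtain ⟨c', a', h', hle⟩ := h.exists_map P hP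
      exact (U2Norm_le h').trans (hle.trans hr.le))

lemma U2.toFun_map (u : U2) (t : ℝ) : (U2.map P hP u).toFun t = P (u.toFun t) := rfl

lemma U2.norm_map_le (u : U2) : ‖U2.map P hP u‖ ≤ ‖u‖ := by
  simpa using (U2.map P hP).le_of_opNorm_le (LinearMap.mkContinuous_norm_le _ zero_le_one _) u

lemma extend_comp (P : L2 →L[ℂ] L2) {u : ℝ → L2} (hu : ∃ l, Tendsto u atBot (𝓝 l)) (x : EReal) :
    extend (fun t => P (u t)) x = P (extend u x) := by
  obtain ⟨l, hl⟩ := hu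
  induction x with
  | bot => rw [extend_bot hl]; exact extend_bot ((P.continuous.tendsto l).comp hl)
  | coe t => simp only [extend_coe]
  | top => simp only [extend_top, map_zero]

lemma variationSum_comp_le (P : L2 →L[ℂ] L2) (hP : ∀ f, ‖P f‖ ≤ ‖f‖) {v : ℝ → L2}
    (hv : ∃ l, Tendsto v atBot (𝓝 l)) (τ : Finset ℝ) :
    variationSum (fun t => P (v t)) τ ≤ variationSum v τ := by
  simp only [variationSum, extend_comp P hv, ← map_sub]
  gcongr with k _
  exact hP _

/-- The action of a contraction on an element of `V²`. -/
def V2.map (v : V2) : V2 :=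
  (⟨fun t => P (v.toFun t), by
    obtain ⟨⟨l, hl⟩, ⟨l', hl'⟩, C, hC⟩ := v.isV2
    refine ⟨⟨_, (P.continuous.tendsto l).comp hl⟩, ⟨_, (P.continuous.tendsto l').comp hl'⟩,
      C, ?_⟩
    rintro _ ⟨τ, rfl⟩
    exact (variationSum_comp_le P hP ⟨l, hl⟩ τ).trans (hC ⟨τ, rfl⟩)⟩ : ↥V2Submodule)

lemma V2.toFun_map (v : V2) (t : ℝ) : (V2.map P hP v).toFun t = P (v.toFun t) := rfl

lemma V2.norm_map_le (v : V2) : ‖V2.map P hP v‖ ≤ ‖v‖ :=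
  ciSup_le fun τ => (variationSum_comp_le P hP v.isV2.1 τ).trans (v.le_norm τ)

/-- A bounded `P` commutes with the limit at `-∞`, so a self-adjoint `P` changes sides in every
partition sum. -/
lemma form_map (hs : ∀ f g, innerL2 (P f) g = innerL2 f (P g)) (u : U2) (v : V2) :
    form (U2.map P hP u) v = form u (V2.map P hP v) := by
  refine form_eq_of_tendsto ((tendsto_form u (V2.map P hP v)).congr fun τ => ?_)
  refine Finset.sum_congr rfl fun k _ => ?_
  have h1 : ∀ x, extend (U2.map P hP u).toFun x = P (extend u.toFun x) :=
    extend_comp P ⟨_, u.tendsto_atBot⟩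
  have h2 : ∀ x, extend (V2.map P hP v).toFun x = P (extend v.toFun x) :=
    extend_comp P v.isV2.1
  rw [h1, h2, h2, hs, map_sub]

end Contraction

lemma U2.norm_extend_le (u : U2) (x : EReal) : ‖extend u.toFun x‖ ≤ ‖u‖ := by
  induction x with
  | bot => rw [extend_bot u.tendsto_atBot, norm_zero]; exact norm_nonneg u
  | coe t => rw [extend_coe]; exact u.norm_apply_le t
  | top => rw [extend_top, norm_zero]; exact norm_nonneg u

lemma V2.norm_extend_le (v : V2) (x : EReal) : ‖extend v.toFun x‖ ≤ ‖v‖ := by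
  induction x with
  | bot =>
    obtain ⟨l, hl⟩ := v.isV2.1
    rw [extend_bot hl]
    exact le_of_tendsto hl.norm (.of_forall v.norm_apply_le)
  | coe t => rw [extend_coe]; exact v.norm_apply_le t
  | top => rw [extend_top, norm_zero]; exact norm_nonneg v

/-! ### Frequency blocks of elements of `X^s_q` and `Y^s_q` -/

section Coordinates

variable {s : ℝ} {q : ℝ≥0∞}

/-- The block `□_k u`. -/
def X.coord (k : ℤ) : X s q →ₗ[ℂ] U2 where
  toFun u := u.2.choose k
  map_add' u v := U2.toFun_injective (funext fun t => by
    simp [u.2.choose_spec.1, v.2.choose_spec.1, (u + v).2.choose_spec.1]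
    exact map_add (box k) _ _)
  map_smul' z u := U2.toFun_injective (funext fun t => by
    simp [u.2.choose_spec.1, (z • u).2.choose_spec.1]
    exact map_smul (box k) _ _)

/-- The block `□_k v`. -/
def Y.coord (k : ℤ) : Y s q →ₗ[ℂ] V2 where
  toFun u := u.2.choose k
  map_add' u v := V2.toFun_injective (funext fun t => by
    simp [u.2.choose_spec.1, v.2.choose_spec.1, (u + v).2.choose_spec.1]
    exact map_add (box k) _ _)
  map_smul' z u := V2.toFun_injective (funext fun t => by
    simp [u.2.choose_spec.1, (z • u).2.choose_spec.1]
    exact map_smul (box k) _ _)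

lemma X.toFun_coord (u : X s q) (k : ℤ) (t : ℝ) : (u.coord k).toFun t = box k (u.toFun t) :=
  u.2.choose_spec.1 k t

lemma Y.toFun_coord (u : Y s q) (k : ℤ) (t : ℝ) : (u.coord k).toFun t = box k (u.toFun t) :=
  u.2.choose_spec.1 k t

lemma X.blocks_apply (u : X s q) (k : ℤ) :
    X.blocks s q u k = (weight s k : ℂ) • u.coord k := rfl

lemma Y.blocks_apply (u : Y s q) (k : ℤ) :
    Y.blocks s q u k = (weight s k : ℂ) • u.coord k := rfl

lemma weight_neg (s : ℝ) (k : ℤ) : weight (-s) k = (weight s k)⁻¹ := by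
  unfold weight
  exact Real.rpow_neg (Real.sqrt_nonneg _) _

lemma norm_weight_smul {E : Type*} [NormedAddCommGroup E] [NormedSpace ℂ E] (s : ℝ) (k : ℤ)
    (x : E) : ‖(weight s k : ℂ) • x‖ = weight s k * ‖x‖ := by
  rw [norm_smul, Complex.norm_real, Real.norm_of_nonneg (weight_pos s k).le]

variable [Fact (1 ≤ q)]

lemma X.norm_def (u : X s q) : ‖u‖ = ‖X.blocks s q u‖ := rfl

lemma Y.norm_def (u : Y s q) : ‖u‖ = ‖Y.blocks s q u‖ := rfl

lemma ne_zero_of_one_le : q ≠ 0 := (zero_lt_one.trans_le (Fact.out : 1 ≤ q)).ne'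

lemma X.norm_coord_le (u : X s q) (k : ℤ) : ‖u.coord k‖ ≤ ‖u‖ * weight (-s) k := by
  have := lp.norm_apply_le_norm ne_zero_of_one_le (X.blocks s q u) k
  rw [X.blocks_apply, norm_weight_smul, ← X.norm_def] at this
  rwa [weight_neg, ← div_eq_mul_inv, le_div_iff₀' (weight_pos s k)]

lemma Y.norm_coord_le (u : Y s q) (k : ℤ) : ‖u.coord k‖ ≤ ‖u‖ * weight (-s) k := by
  have := lp.norm_apply_le_norm ne_zero_of_one_le (Y.blocks s q u) k
  rw [Y.blocks_apply, norm_weight_smul, ← Y.norm_def] at this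
  rwa [weight_neg, ← div_eq_mul_inv, le_div_iff₀' (weight_pos s k)]

lemma box_extend {f : ℝ → FourierL2loc} {r C : ℝ} (hC0 : 0 ≤ C)
    (hC : ∀ t k, ‖box k (f t)‖ ≤ C * weight r k)
    (hf : ∀ k, ∃ l, Tendsto (fun t => box k (f t)) atBot (𝓝 l)) (k : ℤ) (x : EReal) :
    box k (extend f x) = extend (fun t => box k (f t)) x := by
  choose h hh using hf
  obtain ⟨w, hw, e⟩ := exists_tendsto_of_box hC0 hC hh
  induction x with
  | bot => rw [extend_bot hw, extend_bot (hh k), e]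
  | coe t => simp only [extend_coe]
  | top => simp only [extend_top, map_zero]

lemma X.box_extend (u : X s q) (k : ℤ) (x : EReal) :
    box k (extend u.toFun x) = extend (u.coord k).toFun x := by
  rw [show (u.coord k).toFun = fun t => box k (u.toFun t) from funext (u.toFun_coord k)]
  refine UVDuality.box_extend (norm_nonneg u) (r := -s) (fun t k => ?_) (fun k => ?_) k x
  · rw [← X.toFun_coord]
    exact ((u.coord k).norm_apply_le t).trans (u.norm_coord_le k)
  · exact ⟨0, (u.coord k).tendsto_atBot.congr (u.toFun_coord k)⟩

lemma Y.box_extend (u : Y s q) (k : ℤ) (x : EReal) :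
    box k (extend u.toFun x) = extend (u.coord k).toFun x := by
  rw [show (u.coord k).toFun = fun t => box k (u.toFun t) from funext (u.toFun_coord k)]
  refine UVDuality.box_extend (norm_nonneg u) (r := -s) (fun t k => ?_) (fun k => ?_) k x
  · rw [← Y.toFun_coord]
    exact ((u.coord k).norm_apply_le t).trans (u.norm_coord_le k)
  · obtain ⟨l, hl⟩ := (u.coord k).isV2.1
    exact ⟨l, hl.congr (u.toFun_coord k)⟩

end Coordinates

/-! ### The form `B` on `X^s_q × Y^{-s}_{q'}` -/

section Form

variable {s : ℝ} {q q' : ℝ≥0∞}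

lemma norm_coord_mul (u : X s q) (v : Y (-s) q') (k : ℤ) :
    ‖X.blocks s q u k‖ * ‖Y.blocks (-s) q' v k‖ = ‖u.coord k‖ * ‖v.coord k‖ := by
  rw [X.blocks_apply, Y.blocks_apply, norm_weight_smul, norm_weight_smul, weight_neg]
  have := weight_pos s k
  field_simp

variable [Fact (1 ≤ q)] [Fact (1 ≤ q')]

lemma hoelder (hq : q ≠ ⊤) (hqq' : q.HolderConjugate q') (u : X s q) (v : Y (-s) q') :
    (Summable fun k => ‖u.coord k‖ * ‖v.coord k‖) ∧
      ∑' k, ‖u.coord k‖ * ‖v.coord k‖ ≤ ‖u‖ * ‖v‖ := by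
  have := lp_hoelder hq hqq' (X.blocks s q u) (Y.blocks (-s) q' v)
  simp only [norm_coord_mul] at this
  exact this

lemma summable_innerL2_box (hq : q ≠ ⊤) (hqq' : q.HolderConjugate q') (u : X s q)
    (v : Y (-s) q') (x y : EReal) :
    Summable fun k => innerL2 (box k (extend u.toFun x)) (box k (extend v.toFun y)) := by
  refine Summable.of_norm_bounded (hoelder hq hqq' u v).1 fun k => ?_
  rw [u.box_extend, v.box_extend]
  refine (norm_innerL2_le _ _).trans ?_
  gcongr
  · exact (u.coord k).norm_extend_le x
  · exact (v.coord k).norm_extend_le y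

/-- A partition sum is a finite sum of convergent series over `k`, so the order of summation may be
exchanged. -/
lemma hasSum_partitionSum_coord (hq : q ≠ ⊤) (hqq' : q.HolderConjugate q') (u : X s q)
    (v : Y (-s) q') (τ : Finset ℝ) :
    HasSum (fun k => partitionSum innerL2 (u.coord k).toFun (v.coord k).toFun τ)
      (partitionSum pairing u.toFun v.toFun τ) := by
  refine hasSum_sum fun i _ => ?_
  have hs : Summable fun k => innerL2 (box k (extend u.toFun (node τ i)))
      (box k (extend v.toFun (node τ (i + 1)) - extend v.toFun (node τ i))) := by
    simp only [map_sub, innerL2_sub_right]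
    exact (summable_innerL2_box hq hqq' u v _ _).sub (summable_innerL2_box hq hqq' u v _ _)
  have e : ∀ k, innerL2 (box k (extend u.toFun (node τ i)))
      (box k (extend v.toFun (node τ (i + 1)) - extend v.toFun (node τ i))) =
      innerL2 (extend (u.coord k).toFun (node τ i))
        (extend (v.coord k).toFun (node τ (i + 1)) - extend (v.coord k).toFun (node τ i)) :=
    fun k => by rw [map_sub, u.box_extend, v.box_extend, v.box_extend]
  have h := hs.hasSum
  simp only [e] at h
  simpa only [pairing, e] using h

/-- Each block converges to its form, and `‖□_k u‖ ‖□_k v‖` dominates for all partitions and is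
summable by Hölder. -/
lemma tendsto_partitionSum_pairing (hq : q ≠ ⊤) (hqq' : q.HolderConjugate q') (u : X s q)
    (v : Y (-s) q') : Tendsto (partitionSum pairing u.toFun v.toFun) atTop
      (𝓝 (∑' k, form (u.coord k) (v.coord k))) := by
  rw [show partitionSum pairing u.toFun v.toFun = fun τ =>
    ∑' k, partitionSum innerL2 (u.coord k).toFun (v.coord k).toFun τ from
    funext fun τ => (hasSum_partitionSum_coord hq hqq' u v τ).tsum_eq.symm]
  exact tendsto_tsum_of_dominated_convergence (hoelder hq hqq' u v).1
    (fun k => tendsto_form _ _) (.of_forall fun τ k => (u.coord k).norm_partitionSum_le _ τ)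

lemma B_eq_tsum (hq : q ≠ ⊤) (hqq' : q.HolderConjugate q') (u : X s q) (v : Y (-s) q') :
    B u.toFun v.toFun = ∑' k, form (u.coord k) (v.coord k) :=
  (tendsto_partitionSum_pairing hq hqq' u v).limUnder_eq

lemma hasSum_B (hq : q ≠ ⊤) (hqq' : q.HolderConjugate q') (u : X s q) (v : Y (-s) q') :
    HasSum (fun k => form (u.coord k) (v.coord k)) (B u.toFun v.toFun) := by
  rw [B_eq_tsum hq hqq']
  exact (Summable.of_norm_bounded (hoelder hq hqq' u v).1 fun k => norm_form_le _ _).hasSum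

lemma norm_B_le (hq : q ≠ ⊤) (hqq' : q.HolderConjugate q') (u : X s q) (v : Y (-s) q') :
    ‖B u.toFun v.toFun‖ ≤ ‖u‖ * ‖v‖ := by
  rw [B_eq_tsum hq hqq']
  exact (tsum_of_norm_bounded (hoelder hq hqq' u v).1.hasSum fun k => norm_form_le _ _).trans
    (hoelder hq hqq' u v).2

/-- On `U² × V²`, the partition sums of `L²`-valued functions are those of distributions. -/
lemma partitionSum_pairing_eq (u : X s q) (v : Y (-s) q') {u₀ : U2} {v₀ : V2}
    (hu : ∀ t, (u.toFun t : 𝓢'(ℝ, ℂ)) = Lp.toTemperedDistribution (u₀.toFun t))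
    (hv : ∀ t, (v.toFun t : 𝓢'(ℝ, ℂ)) = Lp.toTemperedDistribution (v₀.toFun t))
    (τ : Finset ℝ) :
    partitionSum pairing u.toFun v.toFun τ = partitionSum innerL2 u₀.toFun v₀.toFun τ := by
  have h1 : ∀ k x, box k (extend u.toFun x) = bandProj k (extend u₀.toFun x) := fun k x => by
    rw [u.box_extend, ← extend_comp _ ⟨_, u₀.tendsto_atBot⟩]
    congr 1
    funext t
    rw [u.toFun_coord, box_of_eq_toTemperedDistribution (hu t)]
  have h2 : ∀ k x, box k (extend v.toFun x) = bandProj k (extend v₀.toFun x) := fun k x => by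
    rw [v.box_extend, ← extend_comp _ v₀.isV2.1]
    congr 1
    funext t
    rw [v.toFun_coord, box_of_eq_toTemperedDistribution (hv t)]
  refine Finset.sum_congr rfl fun i _ => ?_
  simp only [pairing, map_sub, h1, h2]
  simp only [← map_sub]
  -- Parseval over the bands, at each pair of nodes.
  exact (hasSum_innerL2_bandProj _ _).tsum_eq

/-- `T v = B(·, v)` as a functional on `X^s_q`. -/
def dualFunctional (hq : q ≠ ⊤) (hqq' : q.HolderConjugate q') (v : Y (-s) q') :
    StrongDual ℂ (X s q) :=
  LinearMap.mkContinuous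
    { toFun := fun u => B u.toFun v.toFun
      map_add' := fun u u' => by
        refine (hasSum_B hq hqq' (u + u') v).unique ?_
        simpa only [map_add, form_add_left] using
          (hasSum_B hq hqq' u v).add (hasSum_B hq hqq' u' v)
      map_smul' := fun z u => by
        refine (hasSum_B hq hqq' (z • u) v).unique ?_
        simp only [map_smul, form_smul_left]
        exact (hasSum_B hq hqq' u v).mul_left z } ‖v‖
    (fun u => by rw [mul_comm]; exact norm_B_le hq hqq' u v)

lemma dualFunctional_apply (hq : q ≠ ⊤) (hqq' : q.HolderConjugate q') (v : Y (-s) q')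
    (u : X s q) : dualFunctional hq hqq' v u = B u.toFun v.toFun := rfl

lemma norm_dualFunctional_le (hq : q ≠ ⊤) (hqq' : q.HolderConjugate q') (v : Y (-s) q') :
    ‖dualFunctional hq hqq' v‖ ≤ ‖v‖ :=
  LinearMap.mkContinuous_norm_le _ (norm_nonneg v) _

end Form

/-! ### Elements of `X^s_q` with a single frequency block -/

section Single

variable {s : ℝ} {q : ℝ≥0∞}

/-- The projection of an element of `U²` to the band `k`. -/
abbrev U2.band (k : ℤ) : U2 →L[ℂ] U2 := U2.map (bandProj k) (norm_bandProj_le k)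

/-- The projection of an element of `V²` to the band `k`. -/
abbrev V2.band (k : ℤ) (v : V2) : V2 := V2.map (bandProj k) (norm_bandProj_le k) v

lemma form_band (k : ℤ) (u : U2) (v : V2) :
    form (U2.band k u) v = form u (V2.band k v) :=
  form_map _ _ (innerL2_bandProj_left k) u v

lemma U2.band_coord (k : ℤ) (u : X s q) : U2.band k (u.coord k) = u.coord k :=
  U2.toFun_injective (funext fun t => by
    rw [U2.toFun_map, X.toFun_coord, bandProj_box_self])

lemma U2.band_band (k : ℤ) (u : U2) : U2.band k (U2.band k u) = U2.band k u :=
  U2.toFun_injective (funext fun t => by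
    rw [U2.toFun_map, U2.toFun_map, bandProj_apply k (u.toFun t), bandProj_box_self])

lemma V2.band_coord (k : ℤ) (v : Y s q) : V2.band k (v.coord k) = v.coord k :=
  V2.toFun_injective (funext fun t => by
    rw [V2.toFun_map, Y.toFun_coord, bandProj_box_self])

lemma single_blocks (k : ℤ) (u : U2) (j : ℤ) (t : ℝ) :
    ((Pi.single k (U2.band k u) : ℤ → U2) j).toFun t =
      box j (synth 0 (bandProj k (u.toFun t))) := by
  rw [← bandProj_apply]
  by_cases hj : j = k
  · subst hj
    rw [Pi.single_eq_same, bandProj_apply j (u.toFun t), bandProj_box_self]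
    exact (bandProj_apply j _)
  · rw [Pi.single_eq_of_ne hj, bandProj_apply k, bandProj_box_of_ne hj]
    simp

lemma weight_smul_single (k : ℤ) (u : U2) :
    (fun j => (weight s j : ℂ) • (Pi.single k (U2.band k u) : ℤ → U2) j) =
      (lp.single q k ((weight s k : ℂ) • U2.band k u) : lp (fun _ : ℤ => U2) q) := by
  funext j
  rw [lp.coeFn_single]
  by_cases hj : j = k
  · subst hj; simp
  · simp [hj]

lemma memℓp_single (k : ℤ) (u : U2) :
    Memℓp (fun j => (weight s j : ℂ) • (Pi.single k (U2.band k u) : ℤ → U2) j) q := by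
  rw [weight_smul_single (q := q)]
  exact lp.memℓp _

/-- The element of `X^s_q` whose only frequency block is the block `k` of `u`. -/
def X.single (k : ℤ) (u : U2) : X s q :=
  (⟨fun t => synth 0 (bandProj k (u.toFun t)), Pi.single k (U2.band k u), single_blocks k u,
    memℓp_single k u⟩ : ↥(blockSubmodule U2.toFun s q))

lemma X.coord_single (k : ℤ) (u : U2) (j : ℤ) :
    (X.single k u : X s q).coord j = (Pi.single k (U2.band k u) : ℤ → U2) j :=
  U2.toFun_injective (funext fun t => by
    rw [X.toFun_coord, single_blocks]; rfl)

lemma X.blocks_single (k : ℤ) (u : U2) : X.blocks s q (X.single k u) =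
    lp.single q k ((weight s k : ℂ) • U2.band k u) := by
  refine lp.ext ?_
  rw [← weight_smul_single]
  funext j
  rw [X.blocks_apply, X.coord_single]

lemma X.blocks_injective : Function.Injective (X.blocks s q) :=
  UVDuality.blocks_injective U2.toFun U2.toFun_injective s q

lemma Y.eq_zero_of_coord (v : Y s q) (h : ∀ k, v.coord k = 0) : v = 0 := by
  have h0 : Y.blocks s q v = 0 := lp.ext (funext fun k => by
    rw [Y.blocks_apply, h, smul_zero]
    rfl)
  exact UVDuality.blocks_injective V2.toFun V2.toFun_injective s q (h0.trans (map_zero _).symm)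

lemma X.single_band (k : ℤ) (g : U2) : (X.single k (U2.band k g) : X s q) = X.single k g :=
  X.blocks_injective (by rw [X.blocks_single, X.blocks_single, U2.band_band])

variable [Fact (1 ≤ q)]

lemma X.norm_single (k : ℤ) (u : U2) :
    ‖(X.single k u : X s q)‖ = weight s k * ‖U2.band k u‖ := by
  rw [X.norm_def, X.blocks_single, lp.norm_single (zero_lt_one.trans_le Fact.out),
    norm_weight_smul]

/-- `X.single` as a continuous linear map. -/
def X.singleL (k : ℤ) : U2 →L[ℂ] X s q :=
  LinearMap.mkContinuous
    { toFun := X.single k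
      map_add' := fun u v => X.blocks_injective (by
        simp only [map_add, X.blocks_single, smul_add]
        exact lp.single_add ..)
      map_smul' := fun z u => X.blocks_injective (by
        simp only [map_smul, X.blocks_single, smul_comm _ z, RingHom.id_apply]
        exact lp.single_smul ..) } (weight s k)
    (fun u => (X.norm_single k u).trans_le (by
      have := (weight_pos s k).le
      gcongr
      exact U2.norm_map_le _ _ u))

lemma X.singleL_apply (k : ℤ) (u : U2) : (X.singleL k u : X s q) = X.single k u := rfl

/-- `X.blocks` is an isometric embedding, so convergence may be checked in `ℓ^q`, where `q < ∞`
makes a sequence the sum of its entries. -/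
lemma X.hasSum_single (hq : q ≠ ⊤) (u : X s q) : HasSum (fun k => X.single k (u.coord k)) u := by
  let I : X s q →ₗᵢ[ℂ] lp (fun _ : ℤ => U2) q := ⟨X.blocks s q, fun _ => rfl⟩
  refine (Topology.IsInducing.hasSum_iff (g := I) I.isometry.isEmbedding.isInducing _ u).1 ?_
  have e : I ∘ (fun k => X.single k (u.coord k)) =
      fun k => lp.single q k (X.blocks s q u k) := funext fun k => by
    refine (X.blocks_single k _).trans ?_
    rw [U2.band_coord, X.blocks_apply]
  rw [e]
  exact lp.hasSum_single hq (X.blocks s q u)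

/-- The factor `weight (-s) k` cancels the weight of the norm, so the `k`-th weighted block has norm
at most `b k`. -/
lemma X.norm_sum_single_le (hq : q ≠ ⊤) (F : Finset ℤ) (b : ℤ → NNReal)
    (hb : ∑ k ∈ F, b k ^ q.toReal ≤ 1) {g : ℤ → U2} (hg : ∀ k, ‖g k‖ ≤ 1) :
    ‖∑ k ∈ F, (X.single k (((weight (-s) k * b k : ℝ) : ℂ) • g k) : X s q)‖ ≤ 1 := by
  have hq0 : 0 < q.toReal := ENNReal.toReal_pos ne_zero_of_one_le hq
  rw [X.norm_def, map_sum]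
  simp only [X.blocks_single]
  rw [← Real.rpow_le_rpow_iff (norm_nonneg _) zero_le_one hq0, Real.one_rpow,
    lp.norm_sum_single hq0]
  have hb' : ∑ k ∈ F, (b k : ℝ) ^ q.toReal ≤ 1 := by exact_mod_cast hb
  refine le_trans (Finset.sum_le_sum fun k _ => ?_) hb'
  have hw := weight_pos s k
  gcongr
  rw [norm_weight_smul, map_smul, norm_smul, Complex.norm_real, weight_neg,
    Real.norm_of_nonneg (by positivity)]
  calc weight s k * ((weight s k)⁻¹ * b k * ‖U2.band k (g k)‖)
      = b k * ‖U2.band k (g k)‖ := by field_simp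
    _ ≤ b k * 1 := by
        gcongr
        exact (U2.norm_map_le _ _ _).trans (hg k)
    _ = b k := mul_one _

end Single

/-! ### Duality -/

section Duality

variable {s : ℝ} {q q' : ℝ≥0∞} [Fact (1 ≤ q)] [Fact (1 ≤ q')]

/-- One block survives, and the projection of `g` to its band moves to `□_k v`, which it fixes. -/
lemma B_single (hq : q ≠ ⊤) (hqq' : q.HolderConjugate q') (k : ℤ) (g : U2) (v : Y (-s) q') :
    B (X.single k g : X s q).toFun v.toFun = form g (v.coord k) := by
  rw [B_eq_tsum hq hqq', tsum_eq_single k]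
  · rw [X.coord_single, Pi.single_eq_same, form_band, V2.band_coord]
  · intro j hj
    rw [X.coord_single, Pi.single_eq_of_ne hj]
    exact map_zero (formL _)

lemma eq_zero_of_dualFunctional (hq : q ≠ ⊤) (hqq' : q.HolderConjugate q') (v : Y (-s) q')
    (h : dualFunctional (s := s) hq hqq' v = 0) : v = 0 :=
  v.eq_zero_of_coord fun k => V2.eq_zero_of_form _ fun g => by
    rw [← B_single hq hqq' k g v, ← dualFunctional_apply hq hqq', h]
    rfl

/-- An element of `Y^{-s}_{q'}` with prescribed blocks. -/
lemma Y.exists_of_coord {g : ℤ → V2} (hg : ∀ k, V2.band k (g k) = g k)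
    (hm : Memℓp (fun k => (weight s k : ℂ) • g k) q) :
    ∃ v : Y s q, (∀ k, v.coord k = g k) ∧ ‖v‖ = ‖(⟨_, hm⟩ : lp (fun _ : ℤ => V2) q)‖ := by
  set G : lp (fun _ : ℤ => V2) q := ⟨_, hm⟩ with hG
  have hC : ∀ t k, ‖(g k).toFun t‖ ≤ ‖G‖ * weight (-s) k := fun t k => by
    have h := lp.norm_apply_le_norm ne_zero_of_one_le G k
    rw [show G k = (weight s k : ℂ) • g k from rfl, norm_weight_smul] at h
    refine ((g k).norm_apply_le t).trans ?_
    rwa [weight_neg, ← div_eq_mul_inv, le_div_iff₀' (weight_pos s k)]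
  have hb : ∀ t k, bandProj k ((g k).toFun t) = (g k).toFun t := fun t k => by
    exact congrArg (fun v : V2 => v.toFun t) (hg k)
  let v : Y s q := (⟨fun t => synth (⌈|-s|⌉₊ + 1)
    (∑' j, blockTerm (⌈|-s|⌉₊ + 1) (fun k => (g k).toFun t) j), g,
    fun k t => (exists_box_eq (norm_nonneg G) (hC t) (hb t) k).symm, hm⟩ :
      ↥(blockSubmodule V2.toFun s q))
  have hv : ∀ k, v.coord k = g k := fun k => V2.toFun_injective (funext fun t => by
    rw [Y.toFun_coord]
    exact exists_box_eq (norm_nonneg G) (hC t) (hb t) k)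
  refine ⟨v, hv, ?_⟩
  rw [Y.norm_def]
  congr 1
  refine lp.ext (funext fun k => ?_)
  rw [Y.blocks_apply, hv]

/-- The norms of the restrictions of a functional to the single blocks, tested against `ℓ^q`. -/
lemma sum_opNorm_single_le (hq : q ≠ ⊤) (L : StrongDual ℂ (X s q)) (F : Finset ℤ)
    (b : ℤ → NNReal) (hb : ∑ k ∈ F, b k ^ q.toReal ≤ 1) :
    ∑ k ∈ F, weight (-s) k * ‖L ∘L X.singleL k‖ * b k ≤ ‖L‖ := by
  set S := ∑ k ∈ F, weight (-s) k * ‖L ∘L X.singleL k‖ * b k with hS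
  -- Nearly norming vectors for the block functionals are added up into one element of the unit ball
  -- of `X`; as their values are real, no cancellation of phases occurs.
  have key : ∀ θ < 1, θ * S ≤ ‖L‖ := by
    intro θ hθ
    choose g r hg hr hθr using fun k => exists_apply_eq_real (L ∘L X.singleL k) hθ
    have h1 : L (∑ k ∈ F, X.single k (((weight (-s) k * b k : ℝ) : ℂ) • g k)) =
        ((∑ k ∈ F, weight (-s) k * b k * r k : ℝ) : ℂ) := by
      rw [map_sum, Complex.ofReal_sum]
      refine Finset.sum_congr rfl fun k _ => ?_
      have h2 := hr k
      rw [ContinuousLinearMap.comp_apply] at h2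
      rw [← X.singleL_apply, map_smul, map_smul, h2, smul_eq_mul]
      push_cast
      ring
    calc θ * S = ∑ k ∈ F, weight (-s) k * b k * (θ * ‖L ∘L X.singleL k‖) := by
          rw [hS, Finset.mul_sum]
          exact Finset.sum_congr rfl fun k _ => by ring
      _ ≤ ∑ k ∈ F, weight (-s) k * b k * r k := by
          refine Finset.sum_le_sum fun k _ => ?_
          have := weight_pos (-s) k
          gcongr
          exact hθr k
      _ ≤ ‖((∑ k ∈ F, weight (-s) k * b k * r k : ℝ) : ℂ)‖ := by
          rw [Complex.norm_real]; exact le_abs_self _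
      _ ≤ ‖L‖ * 1 := by
          rw [← h1]
          exact L.le_opNorm_of_le (X.norm_sum_single_le hq F b hb hg)
      _ = ‖L‖ := mul_one _
  have hlim : Tendsto (fun θ : ℝ => θ * S) (𝓝[<] 1) (𝓝 (1 * S)) :=
    (tendsto_id.mul_const S).mono_left nhdsWithin_le_nhds
  rw [one_mul] at hlim
  exact le_of_tendsto hlim (eventually_nhdsWithin_of_forall key)

/-- Each restriction of `L` to a single block has a representative in `V²`. Projecting it to the
band does not increase its norm and makes it the block of a distribution; the tested bound on the
norms places the sequence in `ℓ^{q'}`. -/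
theorem exists_dualFunctional_eq (hq : q ≠ ⊤) (hqq' : q.HolderConjugate q')
    (L : StrongDual ℂ (X s q)) :
    ∃ v : Y (-s) q', ‖v‖ ≤ ‖L‖ ∧ dualFunctional hq hqq' v = L := by
  choose w hw hLw using fun k => exists_form_eq (L ∘L X.singleL k)
  have hband : ∀ k, V2.band k (V2.band k (w k)) = V2.band k (w k) := fun k =>
    V2.toFun_injective (funext fun t => by
      rw [V2.toFun_map, V2.toFun_map, bandProj_apply k ((w k).toFun t), bandProj_box_self])
  obtain ⟨hm, hle⟩ := exists_memℓp_of_test (q' := q') hq hqq' (norm_nonneg L)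
    (g := fun k => (weight (-s) k : ℂ) • V2.band k (w k)) (fun F b hb => by
      refine le_trans (Finset.sum_le_sum fun k _ => ?_) (sum_opNorm_single_le hq L F b hb)
      have := weight_pos (-s) k
      rw [norm_weight_smul]
      gcongr
      exact (V2.norm_map_le _ _ _).trans (hw k))
  obtain ⟨v, hv, hnorm⟩ := Y.exists_of_coord hband hm
  refine ⟨v, hnorm.trans_le hle, ?_⟩
  ext u
  refine (hasSum_B hq hqq' u v).unique ?_
  -- The projection moves from the representative to `u.coord k`, and `X.single k` does not see it.
  have e : ∀ k, form (u.coord k) (v.coord k) = L (X.single k (u.coord k)) := fun k => by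
    rw [hv, ← form_band, ← hLw, ContinuousLinearMap.comp_apply, X.singleL_apply, X.single_band]
  simp only [e]
  exact (X.hasSum_single hq u).mapL L

/-- The conjugate-linear isometry `v ↦ B(·, v)`. -/
def dualIsometry (hq : q ≠ ⊤) (hqq' : q.HolderConjugate q') :
    Y (-s) q' →ₗᵢ⋆[ℂ] StrongDual ℂ (X s q) :=
  let T : Y (-s) q' →ₗ⋆[ℂ] StrongDual ℂ (X s q) :=
    { toFun := dualFunctional hq hqq'
      map_add' := fun v v' => by
        ext u
        refine (hasSum_B hq hqq' u (v + v')).unique ?_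
        simp only [map_add, form_add_right]
        exact (hasSum_B hq hqq' u v).add (hasSum_B hq hqq' u v')
      map_smul' := fun z v => by
        ext u
        refine (hasSum_B hq hqq' u (z • v)).unique ?_
        simp only [map_smul, form_smul_right]
        exact (hasSum_B hq hqq' u v).mul_left _ }
  { T with
    norm_map' := fun v => by
      -- For the lower bound, `T v` has a preimage `w` with `‖w‖ ≤ ‖T v‖`, and injectivity gives `w
      -- = v`.
      refine le_antisymm (norm_dualFunctional_le hq hqq' v) ?_
      obtain ⟨w, hw, e⟩ := exists_dualFunctional_eq hq hqq' (T v)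
      have : v - w = 0 := eq_zero_of_dualFunctional hq hqq' _
        ((map_sub T v w).trans (sub_eq_zero.2 e.symm))
      rw [sub_eq_zero.1 this] at hw ⊢
      exact hw }

lemma dualIsometry_surjective (hq : q ≠ ⊤) (hqq' : q.HolderConjugate q') :
    Function.Surjective (dualIsometry (s := s) hq hqq') := fun L => by
  obtain ⟨v, -, e⟩ := exists_dualFunctional_eq hq hqq' L
  exact ⟨v, e⟩

end Duality

end UVDuality

end

/-! ### The duality theorem for `X^s_q` and `Y^{-s}_{q'}` -/

theorem mainTheorem4 (s : ℝ) (q q' : ℝ≥0∞) [Fact (1 ≤ q)] [Fact (1 ≤ q')] (hq : q ≠ ⊤)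
    (hqq' : q.HolderConjugate q') :
    -- the form `B` is well defined on `X^s_q × Y^{-s}_{q'}`
    (∀ (u : UVDuality.X s q) (v : UVDuality.Y (-s) q'),
      (∀ t t' : ℝ, Summable fun k : ℤ =>
        UVDuality.innerL2 (UVDuality.box k (u.toFun t)) (UVDuality.box k (v.toFun t'))) ∧
      Tendsto (UVDuality.partitionSum UVDuality.pairing u.toFun v.toFun) atTop
        (𝓝 (UVDuality.B u.toFun v.toFun))) ∧
    -- where `u`, `v` are in `U²`, `V²`, it is the `U²`-`V²` duality form of `L²`-valued functions
    (∀ (u : UVDuality.X s q) (v : UVDuality.Y (-s) q') (u₀ : UVDuality.U2) (v₀ : UVDuality.V2),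
      (∀ t, (u.toFun t : 𝓢'(ℝ, ℂ)) = Lp.toTemperedDistribution (u₀.toFun t)) →
      (∀ t, (v.toFun t : 𝓢'(ℝ, ℂ)) = Lp.toTemperedDistribution (v₀.toFun t)) →
      Tendsto (UVDuality.partitionSum UVDuality.innerL2 u₀.toFun v₀.toFun) atTop
        (𝓝 (UVDuality.B u.toFun v.toFun))) ∧
    (∀ (u : UVDuality.X s q) (v : UVDuality.Y (-s) q'),
      ‖UVDuality.B u.toFun v.toFun‖ ≤ ‖u‖ * ‖v‖) ∧
    -- `v ↦ B(·, v)` is an isometry of `Y^{-s}_{q'}` onto the dual space of `X^s_q`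
    ∃ T : UVDuality.Y (-s) q' ≃ₗᵢ⋆[ℂ] StrongDual ℂ (UVDuality.X s q),
      ∀ v u, T v u = UVDuality.B u.toFun v.toFun := by
  refine ⟨fun u v => ⟨fun t t' => ?_, ?_⟩, fun u v u₀ v₀ hu hv => ?_,
    UVDuality.norm_B_le hq hqq', ?_⟩
  · simpa only [UVDuality.extend_coe] using UVDuality.summable_innerL2_box hq hqq' u v t t'
  · rw [UVDuality.B_eq_tsum hq hqq']
    exact UVDuality.tendsto_partitionSum_pairing hq hqq' u v
  · rw [UVDuality.B_eq_tsum hq hqq']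
    exact (UVDuality.tendsto_partitionSum_pairing hq hqq' u v).congr
      (UVDuality.partitionSum_pairing_eq u v hu hv)
  · exact ⟨LinearIsometryEquiv.ofSurjective (UVDuality.dualIsometry hq hqq')
      (UVDuality.dualIsometry_surjective hq hqq'), fun v u => rfl⟩
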